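/- **Proposition 4.4.** Let $n\ge 1$ and let $M=(m_{ij})\in \mathrm{SL}(2n+1,\mathbb{Z})$ have a real eigenvalue $\alpha>0$, $\alpha\neq 1$, whose generalized eigenspace is one-dimensional, all other complex eigenvalues of $M$ being non-real. Let $a\in\mathbb{R}^{2n+1}$ be an eigenvector of $M$ for $\alpha$, let $W\subset\mathbb{C}^{2n+1}$ be the sum of the generalized eigenspaces of $M$ for the eigenvalues with positive imaginary part (so $\dim_{\mathbb C} W=n$), let $b_1,\dots,b_n$ be a basis of $W$, and let $R=(r_{\ell j})$ be the matrix of $M|_W$ in this basis, $Mb_j=\sum_{\ell} r_{\ell j}b_\ell$. Put $u_i=(a^{(i)},b_1^{(i)},\dots,b_n^{(i)})\in\mathbb{R}\times\mathbb{C}^n$ for $1\le i\le 2n+1$, where $x^{(i)}$ denotes the $i$-th coordinate of $x$. Let $G_M$ be the group of holomorphic automorphisms of $\mathbb{H}\times\mathbb{C}^n$ ($\mathbb{H}$ the upper half-plane) generated by $$g_0(w,z)=(\alpha w,R^{\top}z),\qquad g_i(w,z)=(w,z)+u_i\quad(1\le i\le 2n+1).$$ This group acts freely and properly discontinuously; let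 $T_M=(\mathbb{H}\times\mathbb{C}^n)/G_M$ be the quotient complex manifold, of dimension $n+1$. If $M$ is not diagonalizable over $\mathbb{C}$, then $T_M$ admits no locally conformally Kähler structure; that is, there is no pair $(\Omega,\omega)$ consisting of the fundamental form $\Omega$ of a smooth Hermitian metric on $T_M$ (a smooth positive real $(1,1)$-form) and a smooth closed real $1$-form $\omega$ on $T_M$ with $d\Omega=\omega\wedge\Omega$. -/

import Mathlib

open scoped Manifold ContDiff Matrix

noncomputable section

/-! ## Differential forms and locally conformally Kähler structures on complex manifolds -/

namespace ComplexGeometry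

section Forms

variable {E : Type*} [NormedAddCommGroup E] [NormedSpace ℝ E]

/-- A (not necessarily continuous) real `k`-form on the real manifold `X`: an alternating
`k`-linear form on every tangent space. -/
abbrev DiffForm (E : Type*) [NormedAddCommGroup E] [NormedSpace ℝ E]
    (X : Type*) [TopologicalSpace X] [ChartedSpace E X] (k : ℕ) : Type _ :=
  ∀ x : X, TangentSpace 𝓘(ℝ, E) x [⋀^Fin k]→L[ℝ] ℝ

/-- The expression of the form `η` in the chart `e`: the pull-back of `η` under `e⁻¹`, a form
on the open set `e.target` of `E` (only its values on `e.target` are meaningful). -/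
def DiffForm.inChart {X : Type*} [TopologicalSpace X] [ChartedSpace E X] {k : ℕ}
    (η : DiffForm E X k) (e : OpenPartialHomeomorph X E) (y : E) : E [⋀^Fin k]→L[ℝ] ℝ :=
  (η (e.symm y)).compContinuousLinearMap (mfderiv 𝓘(ℝ, E) 𝓘(ℝ, E) e.symm y)

/-- The wedge product of a `1`-form and a `k`-form on a vector space,
`(θ ∧ η)(v₀, …, v_k) = ∑ i, (-1)^i θ(v_i) η(v₀, …, v̂_i, …, v_k)`
(see `wedgeOne_apply`). -/
def wedgeOne {k : ℕ} (θ : E [⋀^Fin 1]→L[ℝ] ℝ) (η : E [⋀^Fin k]→L[ℝ] ℝ) :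
    E [⋀^Fin (k + 1)]→L[ℝ] ℝ :=
  ContinuousAlternatingMap.alternatizeUncurryFin
    (((ContinuousAlternatingMap.ofSubsingleton ℝ E ℝ (0 : Fin 1)).symm θ).smulRight η)

theorem wedgeOne_apply {k : ℕ} (θ : E [⋀^Fin 1]→L[ℝ] ℝ) (η : E [⋀^Fin k]→L[ℝ] ℝ)
    (v : Fin (k + 1) → E) :
    wedgeOne θ η v =
      ∑ i : Fin (k + 1), (-1 : ℝ) ^ (i : ℕ) * (θ (fun _ => v i) * η (i.removeNth v)) := by
  simp only [wedgeOne, ContinuousAlternatingMap.alternatizeUncurryFin_apply]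
  refine Finset.sum_congr rfl fun i _ => ?_
  rw [zsmul_eq_mul]
  push_cast
  rfl

end Forms

/-- A locally conformally Kähler structure on the complex manifold `X` (modelled on the complex
vector space `E`): the fundamental form `Ω` of a Hermitian metric, that is, a smooth real
`2`-form of type `(1,1)` which is positive, together with a closed smooth real `1`-form `ω`
(the Lee form) such that `dΩ = ω ∧ Ω`. All conditions are expressed in the holomorphic charts
of `X`, in which the complex structure of the tangent spaces is that of `E`. -/
structure LCKStructure (E : Type*) [NormedAddCommGroup E] [NormedSpace ℂ E]
    [NormedSpace ℝ E] [IsScalarTower ℝ ℂ E]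
    (X : Type*) [TopologicalSpace X] [ChartedSpace E X] [IsManifold 𝓘(ℂ, E) ω X] where
  /-- the fundamental form -/
  Ω : DiffForm E X 2
  /-- the Lee form -/
  lee : DiffForm E X 1
  smooth_Ω : ∀ e ∈ IsManifold.maximalAtlas 𝓘(ℂ, E) ω X,
    ContDiffOn ℝ ∞ (Ω.inChart e) e.target
  smooth_lee : ∀ e ∈ IsManifold.maximalAtlas 𝓘(ℂ, E) ω X,
    ContDiffOn ℝ ∞ (lee.inChart e) e.target
  /-- `Ω` is of type `(1,1)`: it is invariant under the complex structure. -/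
  invariant : ∀ e ∈ IsManifold.maximalAtlas 𝓘(ℂ, E) ω X, ∀ y ∈ e.target, ∀ v w : E,
    Ω.inChart e y ![Complex.I • v, Complex.I • w] = Ω.inChart e y ![v, w]
  /-- The symmetric form `(v, w) ↦ Ω (v, i w)` is positive definite. -/
  positive : ∀ e ∈ IsManifold.maximalAtlas 𝓘(ℂ, E) ω X, ∀ y ∈ e.target, ∀ v : E, v ≠ 0 →
    0 < Ω.inChart e y ![v, Complex.I • v]
  lee_closed : ∀ e ∈ IsManifold.maximalAtlas 𝓘(ℂ, E) ω X, ∀ y ∈ e.target,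
    extDeriv (lee.inChart e) y = 0
  d_Ω : ∀ e ∈ IsManifold.maximalAtlas 𝓘(ℂ, E) ω X, ∀ y ∈ e.target,
    extDeriv (Ω.inChart e) y = wedgeOne (lee.inChart e y) (Ω.inChart e y)

end ComplexGeometry

/-! ## The manifolds `T_M` -/

namespace InoueType

open Module

/-- The endomorphism of `ℂ^{2n+1}` given by the integral matrix `M`. -/
def complexEnd {n : ℕ} (M : Matrix.SpecialLinearGroup (Fin (2 * n + 1)) ℤ) :
    Module.End ℂ (Fin (2 * n + 1) → ℂ) :=
  Matrix.toLin' ((M : Matrix (Fin (2 * n + 1)) (Fin (2 * n + 1)) ℤ).map (Int.cast : ℤ → ℂ))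

/-- The matrix `M` is diagonalizable over `ℂ`. -/
def IsDiagonalizable {n : ℕ} (M : Matrix.SpecialLinearGroup (Fin (2 * n + 1)) ℤ) : Prop :=
  ∃ (P : GL (Fin (2 * n + 1)) ℂ) (d : Fin (2 * n + 1) → ℂ),
    (M : Matrix (Fin (2 * n + 1)) (Fin (2 * n + 1)) ℤ).map (Int.cast : ℤ → ℂ) =
      (P : Matrix (Fin (2 * n + 1)) (Fin (2 * n + 1)) ℂ) * Matrix.diagonal d *
        ((P⁻¹ : GL (Fin (2 * n + 1)) ℂ) : Matrix (Fin (2 * n + 1)) (Fin (2 * n + 1)) ℂ)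

/-- The sum `W` of the generalized eigenspaces of `M` for the eigenvalues with positive
imaginary part. -/
def upperSpace {n : ℕ} (M : Matrix.SpecialLinearGroup (Fin (2 * n + 1)) ℤ) :
    Submodule ℂ (Fin (2 * n + 1) → ℂ) :=
  ⨆ β ∈ {β : ℂ | 0 < β.im}, (complexEnd M).maxGenEigenspace β

theorem upperSpace_invariant {n : ℕ} (M : Matrix.SpecialLinearGroup (Fin (2 * n + 1)) ℤ)
    (x : Fin (2 * n + 1) → ℂ) (hx : x ∈ upperSpace M) : complexEnd M x ∈ upperSpace M := by
  suffices h : upperSpace M ≤ (upperSpace M).comap (complexEnd M) from h hx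
  refine iSup₂_le fun β hβ y hy => ?_
  have : complexEnd M y ∈ (complexEnd M).maxGenEigenspace β :=
    Module.End.mapsTo_maxGenEigenspace_of_comm (Commute.refl (complexEnd M)) β hy
  exact (le_iSup₂_of_le (f := fun (β : ℂ) (_ : β ∈ {β : ℂ | 0 < β.im}) =>
    (complexEnd M).maxGenEigenspace β) β hβ le_rfl) this

/-- The data from which the manifold `T_M` is constructed: a matrix `M ∈ SL(2n+1, ℤ)` with an
eigenvalue `α > 0`, `α ≠ 1`, whose eigenspace is one-dimensional, all other eigenvalues being
non-real; a real eigenvector `a` for `α`; and a basis `b₁, …, b_n` of the sum `W` of the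
generalized eigenspaces for the eigenvalues in the upper half-plane. (As `W` has dimension `n`,
the eigenvalue `α` is simple.) -/
structure Datum (n : ℕ) where
  M : Matrix.SpecialLinearGroup (Fin (2 * n + 1)) ℤ
  α : ℝ
  α_pos : 0 < α
  α_ne_one : α ≠ 1
  finrank_eigenspace : finrank ℂ ((complexEnd M).eigenspace (α : ℂ)) = 1
  im_ne_zero : ∀ β : ℂ, (complexEnd M).HasEigenvalue β → β ≠ (α : ℂ) → β.im ≠ 0
  a : Fin (2 * n + 1) → ℝ
  a_ne_zero : a ≠ 0
  a_eigen : (M : Matrix (Fin (2 * n + 1)) (Fin (2 * n + 1)) ℤ).map (Int.cast : ℤ → ℝ) *ᵥ a = α • a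
  b : Basis (Fin n) ℂ (upperSpace M)

/-- The complex manifold `ℍ × ℂ^n`, as an open subset of `ℂ × ℂ^n`. -/
def HC (n : ℕ) : TopologicalSpace.Opens (ℂ × (Fin n → ℂ)) :=
  ⟨{p | 0 < p.1.im}, isOpen_lt continuous_const (Complex.continuous_im.comp continuous_fst)⟩

theorem mem_HC {n : ℕ} {p : ℂ × (Fin n → ℂ)} : p ∈ HC n ↔ 0 < p.1.im := Iff.rfl

/-- Translation of `ℍ × ℂ^n` by a vector of `ℝ × ℂ^n`. -/
def transl {n : ℕ} (v : ℝ × (Fin n → ℂ)) : Equiv.Perm (HC n) where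
  toFun p := ⟨(p.1.1 + (v.1 : ℂ), p.1.2 + v.2), by
    have := mem_HC.1 p.2
    simpa [mem_HC] using this⟩
  invFun p := ⟨(p.1.1 - (v.1 : ℂ), p.1.2 - v.2), by
    have := mem_HC.1 p.2
    simpa [mem_HC] using this⟩
  left_inv p := by ext <;> simp
  right_inv p := by ext <;> simp

theorem transl_apply_coe {n : ℕ} (v : ℝ × (Fin n → ℂ)) (p : HC n) :
    ((transl v p : HC n) : ℂ × (Fin n → ℂ)) = (p.1.1 + (v.1 : ℂ), p.1.2 + v.2) := rfl

theorem transl_mul {n : ℕ} (v w : ℝ × (Fin n → ℂ)) : transl v * transl w = transl (v + w) := by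
  ext p <;> simp [transl_apply_coe, add_assoc, add_comm v.1, add_comm v.2]

theorem transl_zero {n : ℕ} : transl (0 : ℝ × (Fin n → ℂ)) = 1 := by
  ext p <;> simp [transl_apply_coe]

theorem transl_inv {n : ℕ} (v : ℝ × (Fin n → ℂ)) : (transl v)⁻¹ = transl (-v) := by
  rw [inv_eq_iff_mul_eq_one, transl_mul, add_neg_cancel, transl_zero]

namespace Datum

variable {n : ℕ} (D : Datum n)

/-- The matrix `R` of the restriction of `M` to `W` in the basis `b`:
`M b_j = ∑ l, R l j • b_l`. -/
def R : Matrix (Fin n) (Fin n) ℂ :=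
  LinearMap.toMatrix D.b D.b
    ((complexEnd D.M).restrict (p := upperSpace D.M) (q := upperSpace D.M)
      (upperSpace_invariant D.M))

/-- The vectors `u_i = (a^{(i)}, b_1^{(i)}, …, b_n^{(i)})` of `ℝ × ℂ^n`. -/
def u (i : Fin (2 * n + 1)) : ℝ × (Fin n → ℂ) :=
  (D.a i, fun j => (D.b j : Fin (2 * n + 1) → ℂ) i)

theorem sum_R (j : Fin n) :
    complexEnd D.M (D.b j) = ∑ l, D.R l j • (D.b l : Fin (2 * n + 1) → ℂ) := by
  have h := D.b.sum_repr ((complexEnd D.M).restrict (p := upperSpace D.M) (q := upperSpace D.M)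
    (upperSpace_invariant D.M) (D.b j))
  have h2 := congrArg (Subtype.val) h
  simp only [LinearMap.coe_restrict_apply] at h2
  rw [← h2]
  simp only [R, LinearMap.toMatrix_apply, Submodule.coe_sum, Submodule.coe_smul]

theorem complexEnd_injective (M : Matrix.SpecialLinearGroup (Fin (2 * n + 1)) ℤ) :
    Function.Injective (complexEnd M) := by
  have h : ((M⁻¹ : Matrix.SpecialLinearGroup (Fin (2 * n + 1)) ℤ) :
      Matrix (Fin (2 * n + 1)) (Fin (2 * n + 1)) ℤ).map (Int.castRingHom ℂ) *
      (M : Matrix (Fin (2 * n + 1)) (Fin (2 * n + 1)) ℤ).map (Int.castRingHom ℂ) = 1 := by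
    rw [← Matrix.map_mul, ← Matrix.SpecialLinearGroup.coe_mul]
    simp
  refine Function.LeftInverse.injective (g := complexEnd M⁻¹) fun x => ?_
  simp only [complexEnd, Matrix.toLin'_apply, Matrix.mulVec_mulVec]
  erw [h]
  simp

theorem isUnit_det_R : IsUnit D.R.det := by
  have hinj : Function.Injective ((complexEnd D.M).restrict (p := upperSpace D.M)
      (q := upperSpace D.M) (upperSpace_invariant D.M)) := fun x y hxy => by
    apply Subtype.ext
    apply complexEnd_injective D.M
    exact congrArg Subtype.val hxy
  have : FiniteDimensional ℂ (upperSpace D.M) := inferInstance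
  have h := LinearEquiv.isUnit_det (LinearEquiv.ofInjectiveEndo _ hinj) D.b D.b
  exact h

/-- The automorphism `g₀ (w, z) = (α w, Rᵀ z)` of `ℍ × ℂ^n`. -/
def g₀ : Equiv.Perm (HC n) where
  toFun p := ⟨((D.α : ℂ) * p.1.1, D.Rᵀ *ᵥ p.1.2), by
    have := mem_HC.1 p.2
    simpa [mem_HC] using mul_pos D.α_pos this⟩
  invFun p := ⟨((D.α : ℂ)⁻¹ * p.1.1, D.Rᵀ⁻¹ *ᵥ p.1.2), by
    have := mem_HC.1 p.2
    rw [← Complex.ofReal_inv]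
    simpa [mem_HC] using mul_pos (inv_pos.2 D.α_pos) this⟩
  left_inv p := by
    have hα : (D.α : ℂ) ≠ 0 := by exact_mod_cast D.α_pos.ne'
    have hR : IsUnit D.Rᵀ.det := by rw [Matrix.det_transpose]; exact D.isUnit_det_R
    ext <;> simp [hα, Matrix.nonsing_inv_mul _ hR]
  right_inv p := by
    have hα : (D.α : ℂ) ≠ 0 := by exact_mod_cast D.α_pos.ne'
    have hR : IsUnit D.Rᵀ.det := by rw [Matrix.det_transpose]; exact D.isUnit_det_R
    ext <;> simp [hα, Matrix.mul_nonsing_inv _ hR]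

/-- The group `G_M` of automorphisms of `ℍ × ℂ^n` generated by `g₀` and the translations
`g_i (w, z) = (w, z) + u_i`. -/
def G : Subgroup (Equiv.Perm (HC n)) :=
  Subgroup.closure (insert D.g₀ (Set.range fun i => transl (D.u i)))

theorem conj_complexEnd (M : Matrix.SpecialLinearGroup (Fin (2 * n + 1)) ℤ)
    (x : Fin (2 * n + 1) → ℂ) : complexEnd M (star x) = star (complexEnd M x) := by
  ext i
  simp [complexEnd, Matrix.mulVec, dotProduct]

theorem star_mem (M : Matrix.SpecialLinearGroup (Fin (2 * n + 1)) ℤ)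
    {x : Fin (2 * n + 1) → ℂ} (hx : x ∈ upperSpace M) :
    star x ∈ ⨆ β ∈ {β : ℂ | β.im < 0}, (complexEnd M).maxGenEigenspace β := by
  let C : (Fin (2 * n + 1) → ℂ) →ₛₗ[starRingEnd ℂ] (Fin (2 * n + 1) → ℂ) :=
    { toFun := star, map_add' := star_add, map_smul' := fun c x => by
        ext i; simp }
  suffices h : upperSpace M ≤
    (⨆ β ∈ {β : ℂ | β.im < 0}, (complexEnd M).maxGenEigenspace β).comap C from h hx
  refine iSup₂_le fun β hβ y hy => ?_
  have hβ' : (starRingEnd ℂ β) ∈ {β : ℂ | β.im < 0} := by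
    simpa using hβ
  refine (le_iSup₂_of_le (f := fun (β : ℂ) (_ : β ∈ {β : ℂ | β.im < 0}) =>
    (complexEnd M).maxGenEigenspace β) _ hβ' le_rfl) ?_
  rw [Module.End.mem_maxGenEigenspace] at hy ⊢
  obtain ⟨k, hk⟩ := hy
  refine ⟨k, ?_⟩
  have key : ∀ (k : ℕ) (z : Fin (2 * n + 1) → ℂ),
      ((complexEnd M - (starRingEnd ℂ β) • 1) ^ k) (star z) =
        star (((complexEnd M - β • 1) ^ k) z) := by
    intro k
    induction k with
    | zero => intro z; simp
    | succ k ih =>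
      intro z
      rw [pow_succ, pow_succ, Module.End.mul_apply, Module.End.mul_apply, ← ih]
      congr 1
      simp [conj_complexEnd]
  change ((complexEnd M - (starRingEnd ℂ β) • 1) ^ k) (star y) = 0
  rw [key, hk, star_zero]

theorem linearIndependent_u : LinearIndependent ℝ D.u := by
  rw [Fintype.linearIndependent_iff]
  intro c hc
  let φ : (Fin (2 * n + 1) → ℂ) →ₗ[ℂ] ℂ := ∑ i, (c i : ℂ) • LinearMap.proj i
  have hφ : ∀ x, φ x = ∑ i, (c i : ℂ) * x i := fun x => by simp [φ]
  have ha : φ (fun i => (D.a i : ℂ)) = 0 := by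
    have := congrArg Prod.fst hc
    rw [hφ]
    simp only [u, Prod.fst_sum, Prod.smul_fst, smul_eq_mul, Prod.fst_zero] at this
    exact_mod_cast this
  have hb : ∀ j, φ (D.b j) = 0 := fun j => by
    have := congrFun (congrArg Prod.snd hc) j
    rw [hφ]
    simpa [u, Prod.snd_sum] using this
  have hb' : ∀ j, φ (star (D.b j : Fin (2 * n + 1) → ℂ)) = 0 := fun j => by
    have := congrArg (starRingEnd ℂ) (hb j)
    rw [hφ] at this ⊢
    simpa using this
  set W' := ⨆ β ∈ {β : ℂ | β.im < 0}, (complexEnd D.M).maxGenEigenspace β with hW'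
  let L' : Submodule ℂ (Fin (2 * n + 1) → ℂ) :=
    Submodule.span ℂ (Set.range fun j => star (D.b j : Fin (2 * n + 1) → ℂ))
  let V : Submodule ℂ (Fin (2 * n + 1) → ℂ) := ℂ ∙ (fun i => (D.a i : ℂ))
  have hind := Module.End.independent_maxGenEigenspace (complexEnd D.M)
  have hL' : L' ≤ W' := by
    rw [Submodule.span_le]
    rintro _ ⟨j, rfl⟩
    exact star_mem D.M (D.b j).2
  have hV : V ≤ ⨆ β ∈ {β : ℂ | β.im = 0}, (complexEnd D.M).maxGenEigenspace β := by
    rw [Submodule.span_singleton_le_iff_mem]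
    refine (le_iSup₂_of_le (f := fun (β : ℂ) (_ : β ∈ {β : ℂ | β.im = 0}) =>
      (complexEnd D.M).maxGenEigenspace β) (D.α : ℂ) (by simp) le_rfl) ?_
    rw [Module.End.mem_maxGenEigenspace]
    refine ⟨1, ?_⟩
    have h := D.a_eigen
    ext i
    have hi := congrArg (fun x : ℝ => (x : ℂ)) (congrFun h i)
    simp only [Matrix.mulVec, dotProduct, Matrix.map_apply, Pi.smul_apply, smul_eq_mul,
      Complex.ofReal_sum, Complex.ofReal_mul, Complex.ofReal_intCast] at hi
    simp [complexEnd, Matrix.mulVec, dotProduct, hi]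
  have hdis1 : Disjoint (upperSpace D.M) L' := by
    refine Disjoint.mono_right hL' (hind.disjoint_biSup_biSup ?_)
    rw [Set.disjoint_left]
    intro β h1 h2
    simp only [Set.mem_ofPred_eq] at h1 h2
    linarith
  have hdis2 : Disjoint (upperSpace D.M ⊔ L') V := by
    have hle : upperSpace D.M ⊔ L' ≤
        ⨆ β ∈ {β : ℂ | β.im ≠ 0}, (complexEnd D.M).maxGenEigenspace β :=
      sup_le (biSup_mono fun β (hβ : 0 < β.im) => hβ.ne')
        (hL'.trans (biSup_mono fun β (hβ : β.im < 0) => hβ.ne))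
    refine Disjoint.mono hle hV (hind.disjoint_biSup_biSup ?_)
    rw [Set.disjoint_left]
    intro β h1 h2
    exact h1 h2
  have hfW : finrank ℂ (upperSpace D.M) = n := by
    rw [finrank_eq_card_basis D.b, Fintype.card_fin]
  have hfL : finrank ℂ L' = n := by
    rw [finrank_span_eq_card, Fintype.card_fin]
    have hli : LinearIndependent ℂ (fun j => (D.b j : Fin (2 * n + 1) → ℂ)) :=
      D.b.linearIndependent.map' (upperSpace D.M).subtype (Submodule.ker_subtype _)
    rw [Fintype.linearIndependent_iff] at hli ⊢
    intro g hg j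
    have h1 := hli (fun j => star (g j)) (by
      have := congrArg star hg
      simpa [star_sum] using this) j
    simpa using h1
  have hfV : finrank ℂ V = 1 := by
    refine finrank_span_singleton fun h => D.a_ne_zero ?_
    ext i
    simpa using congrFun h i
  have htop : (upperSpace D.M ⊔ L') ⊔ V = ⊤ := by
    apply Submodule.eq_top_of_finrank_eq
    have h1 := Submodule.finrank_sup_add_finrank_inf_eq (upperSpace D.M) L'
    have h2 := Submodule.finrank_sup_add_finrank_inf_eq (upperSpace D.M ⊔ L') V
    rw [hdis1.eq_bot, finrank_bot] at h1
    rw [hdis2.eq_bot, finrank_bot] at h2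
    rw [finrank_fin_fun]
    omega
  have hker : (⊤ : Submodule ℂ (Fin (2 * n + 1) → ℂ)) ≤ LinearMap.ker φ := by
    rw [← htop]
    refine sup_le (sup_le ?_ ?_) ?_
    · have : upperSpace D.M = Submodule.span ℂ
          (Set.range fun j => (D.b j : Fin (2 * n + 1) → ℂ)) := by
        have h := congrArg (Submodule.map (upperSpace D.M).subtype) D.b.span_eq
        rw [Submodule.map_span, Submodule.map_top, Submodule.range_subtype, ← Set.range_comp] at h
        exact h.symm
      rw [this, Submodule.span_le]
      rintro _ ⟨j, rfl⟩
      exact hb j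
    · rw [Submodule.span_le]
      rintro _ ⟨j, rfl⟩
      exact hb' j
    · rw [Submodule.span_singleton_le_iff_mem]
      exact ha
  intro i
  have := hker (x := Pi.single i 1) trivial
  rw [LinearMap.mem_ker, hφ] at this
  simpa [Pi.single_apply] using this

theorem g₀_apply_coe (p : HC n) :
    ((D.g₀ p : HC n) : ℂ × (Fin n → ℂ)) = ((D.α : ℂ) * p.1.1, D.Rᵀ *ᵥ p.1.2) := rfl

theorem g₀_inv_apply_coe (p : HC n) :
    ((D.g₀⁻¹ p : HC n) : ℂ × (Fin n → ℂ)) = ((D.α : ℂ)⁻¹ * p.1.1, D.Rᵀ⁻¹ *ᵥ p.1.2) := rfl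

/-- The real linear map `(x, z) ↦ (α x, Rᵀ z)` of `ℝ × ℂ^n`. -/
def A : (ℝ × (Fin n → ℂ)) →ₗ[ℝ] (ℝ × (Fin n → ℂ)) where
  toFun v := (D.α * v.1, D.Rᵀ *ᵥ v.2)
  map_add' v w := by simp [mul_add, Matrix.mulVec_add]
  map_smul' c v := by
    ext <;> simp [Matrix.mulVec_smul, mul_left_comm]

theorem A_apply (v : ℝ × (Fin n → ℂ)) : D.A v = (D.α * v.1, D.Rᵀ *ᵥ v.2) := rfl

/-- The lattice spanned by the vectors `u_i`. -/
def lattice : Submodule ℤ (ℝ × (Fin n → ℂ)) := Submodule.span ℤ (Set.range D.u)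

theorem A_u (i : Fin (2 * n + 1)) :
    D.A (D.u i) = ∑ j, (D.M : Matrix (Fin (2 * n + 1)) (Fin (2 * n + 1)) ℤ) i j • D.u j := by
  ext k
  · have h := congrFun D.a_eigen i
    simp only [Matrix.mulVec, dotProduct, Matrix.map_apply, Pi.smul_apply, smul_eq_mul] at h
    simp [A_apply, u, Prod.fst_sum, ← h]
  · have h := congrFun (D.sum_R k) i
    simp only [complexEnd, Matrix.toLin'_apply, Matrix.mulVec, dotProduct, Matrix.map_apply,
      Finset.sum_apply, Pi.smul_apply, smul_eq_mul] at h
    simp [A_apply, u, Prod.snd_sum, Matrix.mulVec, dotProduct, h]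

theorem A_mem {v : ℝ × (Fin n → ℂ)} (hv : v ∈ D.lattice) : D.A v ∈ D.lattice := by
  induction hv using Submodule.span_induction with
  | mem x hx =>
    obtain ⟨i, rfl⟩ := hx
    rw [A_u]
    exact Submodule.sum_mem _ fun j _ => Submodule.smul_mem _ _
      (Submodule.subset_span ⟨j, rfl⟩)
  | zero => simp
  | add x y _ _ hx hy => rw [map_add]; exact add_mem hx hy
  | smul c x _ hx => rw [map_zsmul]; exact Submodule.smul_mem _ _ hx

theorem exists_A_eq {v : ℝ × (Fin n → ℂ)} (hv : v ∈ D.lattice) :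
    ∃ w ∈ D.lattice, D.A w = v := by
  induction hv using Submodule.span_induction with
  | mem x hx =>
    obtain ⟨i, rfl⟩ := hx
    refine ⟨∑ j, ((D.M⁻¹ : Matrix.SpecialLinearGroup (Fin (2 * n + 1)) ℤ) :
      Matrix (Fin (2 * n + 1)) (Fin (2 * n + 1)) ℤ) i j • D.u j,
      Submodule.sum_mem _ fun j _ => Submodule.smul_mem _ _ (Submodule.subset_span ⟨j, rfl⟩), ?_⟩
    rw [map_sum]
    simp_rw [map_zsmul, A_u, Finset.smul_sum, smul_smul]
    rw [Finset.sum_comm]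
    simp_rw [← Finset.sum_smul, ← Matrix.mul_apply, ← Matrix.SpecialLinearGroup.coe_mul]
    simp [Matrix.one_apply]
  | zero => exact ⟨0, zero_mem _, map_zero _⟩
  | add x y _ _ hx hy =>
    obtain ⟨x', hx', rfl⟩ := hx
    obtain ⟨y', hy', rfl⟩ := hy
    exact ⟨x' + y', add_mem hx' hy', map_add _ _ _⟩
  | smul c x _ hx =>
    obtain ⟨x', hx', rfl⟩ := hx
    exact ⟨c • x', Submodule.smul_mem _ _ hx', map_zsmul _ _ _⟩

theorem g₀_mul_transl (v : ℝ × (Fin n → ℂ)) :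
    D.g₀ * transl v = transl (D.A v) * D.g₀ := by
  ext p <;> simp [transl_apply_coe, g₀_apply_coe, A_apply, mul_add, Matrix.mulVec_add]

theorem exists_zpow_mul_transl (k : ℤ) : ∀ {v : ℝ × (Fin n → ℂ)}, v ∈ D.lattice →
    ∃ w ∈ D.lattice, D.g₀ ^ k * transl v = transl w * D.g₀ ^ k := by
  induction k using Int.induction_on with
  | zero => intro v hv; exact ⟨v, hv, by simp⟩
  | succ k ih =>
    intro v hv
    obtain ⟨w, hw, h⟩ := ih (D.A_mem hv)
    refine ⟨w, hw, ?_⟩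
    rw [zpow_add, zpow_one, mul_assoc, g₀_mul_transl, ← mul_assoc, h, mul_assoc]
  | pred k ih =>
    intro v hv
    obtain ⟨v', hv', rfl⟩ := D.exists_A_eq hv
    obtain ⟨w, hw, h⟩ := ih hv'
    refine ⟨w, hw, ?_⟩
    have h1 : D.g₀⁻¹ * transl (D.A v') = transl v' * D.g₀⁻¹ := by
      rw [inv_mul_eq_iff_eq_mul, ← mul_assoc, g₀_mul_transl, mul_assoc, mul_inv_cancel, mul_one]
    rw [zpow_sub_one, mul_assoc, h1, ← mul_assoc, h, mul_assoc]

theorem mem_G {g : Equiv.Perm (HC n)} (hg : g ∈ D.G) :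
    ∃ (k : ℤ), ∃ v ∈ D.lattice, g = transl v * D.g₀ ^ k := by
  induction hg using Subgroup.closure_induction with
  | mem x hx =>
    rcases hx with rfl | ⟨i, rfl⟩
    · exact ⟨1, 0, zero_mem _, by simp [transl_zero]⟩
    · exact ⟨0, D.u i, Submodule.subset_span ⟨i, rfl⟩, by simp⟩
  | one => exact ⟨0, 0, zero_mem _, by simp [transl_zero]⟩
  | mul x y _ _ hx hy =>
    obtain ⟨k, v, hv, rfl⟩ := hx
    obtain ⟨l, w, hw, rfl⟩ := hy
    obtain ⟨w', hw', h⟩ := D.exists_zpow_mul_transl k hw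
    refine ⟨k + l, v + w', add_mem hv hw', ?_⟩
    rw [zpow_add, ← transl_mul, mul_assoc, ← mul_assoc (D.g₀ ^ k), h]
    simp only [mul_assoc]
  | inv x _ hx =>
    obtain ⟨k, v, hv, rfl⟩ := hx
    obtain ⟨w, hw, h⟩ := D.exists_zpow_mul_transl (-k) (neg_mem hv)
    refine ⟨-k, w, hw, ?_⟩
    rw [mul_inv_rev, transl_inv, ← zpow_neg, h]

theorem im_zpow (k : ℤ) : ∀ p : HC n, ((D.g₀ ^ k) p).1.1.im = D.α ^ k * p.1.1.im := by
  have hα := D.α_pos.ne'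
  induction k using Int.induction_on with
  | zero => intro p; simp
  | succ k ih =>
    intro p
    rw [zpow_add_one, Equiv.Perm.mul_apply, ih, g₀_apply_coe, zpow_add_one₀ hα]
    simp [mul_assoc]
  | pred k ih =>
    intro p
    rw [zpow_sub_one, Equiv.Perm.mul_apply, ih, g₀_inv_apply_coe, zpow_sub_one₀ hα,
      ← Complex.ofReal_inv]
    simp [mul_assoc]

theorem im_transl (v : ℝ × (Fin n → ℂ)) (p : HC n) : (transl v p).1.1.im = p.1.1.im := by
  simp [transl_apply_coe]

theorem zpow_α_injective : Function.Injective fun k : ℤ => D.α ^ k :=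
  zpow_right_injective₀ D.α_pos D.α_ne_one

/-- Every element of `G_M` is the restriction of an affine transformation of `ℂ × ℂ^n`. -/
theorem exists_affine {g : Equiv.Perm (HC n)} (hg : g ∈ D.G) :
    ∃ (B : (ℂ × (Fin n → ℂ)) →L[ℂ] (ℂ × (Fin n → ℂ))) (c : ℂ × (Fin n → ℂ)),
      ∀ p : HC n, ((g p : HC n) : ℂ × (Fin n → ℂ)) = B p + c := by
  let lin (s : ℂ) (N : Matrix (Fin n) (Fin n) ℂ) :
      (ℂ × (Fin n → ℂ)) →L[ℂ] (ℂ × (Fin n → ℂ)) :=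
    LinearMap.toContinuousLinearMap (LinearMap.prodMap (s • LinearMap.id) (Matrix.toLin' N))
  obtain ⟨k, v, -, rfl⟩ := D.mem_G hg
  clear hg
  suffices h : ∃ (B : (ℂ × (Fin n → ℂ)) →L[ℂ] (ℂ × (Fin n → ℂ))),
      ∀ p : HC n, (((D.g₀ ^ k) p : HC n) : ℂ × (Fin n → ℂ)) = B p by
    obtain ⟨B, hB⟩ := h
    refine ⟨B, ((v.1 : ℂ), v.2), fun p => ?_⟩
    rw [Equiv.Perm.mul_apply, transl_apply_coe, hB]
    rfl
  induction k using Int.induction_on with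
  | zero => exact ⟨ContinuousLinearMap.id ℂ _, fun p => by simp⟩
  | succ k ih =>
    obtain ⟨B, hB⟩ := ih
    refine ⟨B.comp (lin D.α D.Rᵀ), fun p => ?_⟩
    rw [zpow_add_one, Equiv.Perm.mul_apply, hB, g₀_apply_coe]
    simp [lin, LinearMap.prodMap_apply]
  | pred k ih =>
    obtain ⟨B, hB⟩ := ih
    refine ⟨B.comp (lin (D.α : ℂ)⁻¹ D.Rᵀ⁻¹), fun p => ?_⟩
    rw [zpow_sub_one, Equiv.Perm.mul_apply, hB, g₀_inv_apply_coe]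
    simp [lin, LinearMap.prodMap_apply]

instance continuousConstSMul_G : ContinuousConstSMul D.G (HC n) where
  continuous_const_smul g := by
    obtain ⟨B, c, h⟩ := D.exists_affine g.2
    refine Continuous.subtype_mk (f := fun p : HC n => ((g.1 p : HC n) : ℂ × (Fin n → ℂ))) ?_ _
    simp_rw [h]
    fun_prop

instance isCancelSMul_G : IsCancelSMul D.G (HC n) := by
  rw [isCancelSMul_iff_eq_one_of_smul_eq]
  rintro ⟨g, hg⟩ p hgp
  apply Subtype.ext
  change g p = p at hgp
  change g = 1
  obtain ⟨k, v, hv, rfl⟩ := D.mem_G hg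
  have him := congrArg (fun q : HC n => q.1.1.im) hgp
  simp only [Equiv.Perm.mul_apply, im_transl, im_zpow] at him
  have hp : 0 < p.1.1.im := mem_HC.1 p.2
  have hk : k = 0 := D.zpow_α_injective (by
    simpa [hp.ne'] using him)
  subst hk
  have hv0 : v = 0 := by
    have h := congrArg (fun q : HC n => q.1) hgp
    simp only [zpow_zero, mul_one, transl_apply_coe] at h
    ext1
    · simpa using congrArg Prod.fst h
    · simpa using congrArg Prod.snd h
  simp [hv0, transl_zero]

theorem finite_lattice_inter {s : Set (ℝ × (Fin n → ℂ))} (hs : Bornology.IsBounded s) :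
    (s ∩ D.lattice).Finite := by
  have hcard : Fintype.card (Fin (2 * n + 1)) = finrank ℝ (ℝ × (Fin n → ℂ)) := by
    simp [Module.finrank_pi_fintype, Complex.finrank_real_complex]
    ring
  let bas := basisOfLinearIndependentOfCardEqFinrank D.linearIndependent_u hcard
  have h := ZSpan.setFinite_inter bas hs
  rwa [coe_basisOfLinearIndependentOfCardEqFinrank] at h

instance properlyDiscontinuousSMul_G : ProperlyDiscontinuousSMul D.G (HC n) where
  finite_disjoint_inter_image := by
    intro K L hK hL
    have hbdd : ∃ m C : ℝ, 0 < m ∧ ∀ p ∈ K ∪ L, m ≤ p.1.1.im ∧ p.1.1.im ≤ C := by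
      rcases (K ∪ L).eq_empty_or_nonempty with h | h
      · exact ⟨1, 0, one_pos, by simp [h]⟩
      have hc : ContinuousOn (fun p : HC n => p.1.1.im) (K ∪ L) := by fun_prop
      obtain ⟨p, -, hp⟩ := (hK.union hL).exists_isMinOn h hc
      obtain ⟨q, -, hq⟩ := (hK.union hL).exists_isMaxOn h hc
      exact ⟨p.1.1.im, q.1.1.im, mem_HC.1 p.2, fun x hx => ⟨hp hx, hq hx⟩⟩
    obtain ⟨m, C, hm, hmC⟩ := hbdd
    have hlog : Real.log D.α ≠ 0 :=
      Real.log_ne_zero_of_pos_of_ne_one D.α_pos D.α_ne_one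
    let N : ℕ := ⌈(Real.log C - Real.log m) / |Real.log D.α|⌉₊
    let S : ℤ → Set (ℝ × (Fin n → ℂ)) := fun k =>
      (fun pq : HC n × HC n => (pq.2.1.1.re - ((D.g₀ ^ k) pq.1).1.1.re,
        pq.2.1.2 - ((D.g₀ ^ k) pq.1).1.2)) '' (K ×ˢ L)
    have hg₀ : D.g₀ ∈ D.G := Subgroup.subset_closure (Set.mem_insert _ _)
    have hS : ∀ k, Bornology.IsBounded (S k) := fun k => by
      have hcont : Continuous (D.g₀ ^ k) :=
        continuous_const_smul (⟨D.g₀ ^ k, D.G.zpow_mem hg₀ k⟩ : D.G)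
      exact ((hK.prod hL).image (by fun_prop)).isBounded
    have hfin : (⋃ k ∈ Set.Icc (-(N : ℤ)) N,
        (fun v => transl v * D.g₀ ^ k) '' (S k ∩ D.lattice)).Finite :=
      (Set.finite_Icc _ _).biUnion fun k _ => (D.finite_lattice_inter (hS k)).image _
    refine (hfin.preimage (f := (Subtype.val : D.G → Equiv.Perm (HC n)))
      Subtype.val_injective.injOn).subset ?_
    rintro ⟨g, hg⟩ ⟨q, ⟨p, hp, hpq⟩, hq⟩
    change g p = q at hpq
    obtain ⟨k, v, hv, rfl⟩ := D.mem_G hg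
    simp only [Set.mem_preimage, Set.mem_iUnion]
    refine ⟨k, ?_, v, ⟨⟨(p, q), ⟨hp, hq⟩, ?_⟩, hv⟩, rfl⟩
    · have him := congrArg (fun q : HC n => q.1.1.im) hpq
      simp only [Equiv.Perm.mul_apply, im_transl, im_zpow] at him
      obtain ⟨hp1, hp2⟩ := hmC p (Or.inl hp)
      obtain ⟨hq1, hq2⟩ := hmC q (Or.inr hq)
      have hlogs := congrArg Real.log him
      rw [Real.log_mul (zpow_pos D.α_pos k).ne' (hm.trans_le hp1).ne', Real.log_zpow] at hlogs
      have l1 := Real.log_le_log hm hp1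
      have l2 := Real.log_le_log (hm.trans_le hp1) hp2
      have l3 := Real.log_le_log hm hq1
      have l4 := Real.log_le_log (hm.trans_le hq1) hq2
      have habs : |(k : ℝ)| ≤ N := by
        refine le_trans ?_ (Nat.le_ceil _)
        rw [le_div_iff₀ (abs_pos.2 hlog), ← abs_mul, abs_le]
        constructor <;> linarith
      rw [abs_le] at habs
      constructor
      · exact_mod_cast habs.1
      · exact_mod_cast habs.2
    · rw [← hpq, Equiv.Perm.mul_apply]
      ext1 <;> simp [transl_apply_coe]

/-- The manifold `T_M = (ℍ × ℂ^n) / G_M`. -/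
abbrev T : Type := MulAction.orbitRel.Quotient D.G (HC n)

instance locallyCompactSpace_HC : LocallyCompactSpace (HC n) :=
  (HC n).isOpen.locallyCompactSpace

theorem chartAt_symm_coe (q : HC n) {y : ℂ × (Fin n → ℂ)}
    (hy : y ∈ (chartAt (ℂ × (Fin n → ℂ)) q).target) :
    (((chartAt (ℂ × (Fin n → ℂ)) q).symm y : HC n) : ℂ × (Fin n → ℂ)) = y :=
  (chartAt (ℂ × (Fin n → ℂ)) q).right_inv hy

theorem isLocalHomeomorph_mk :
    IsLocalHomeomorph (Quotient.mk (MulAction.orbitRel D.G (HC n))) :=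
  isQuotientCoveringMap_quotientMk_of_properlyDiscontinuousSMul.isCoveringMap.isLocalHomeomorph

/-- The transition maps between the charts of `T_M` are locally restrictions of affine maps. -/
theorem contDiffOn_transition (p p' : HC n) :
    ContDiffOn ℂ ω
      (((D.isLocalHomeomorph_mk.localInverseAt p).trans (chartAt (ℂ × (Fin n → ℂ)) p)).symm.trans
        ((D.isLocalHomeomorph_mk.localInverseAt p').trans (chartAt (ℂ × (Fin n → ℂ)) p')))
      (((D.isLocalHomeomorph_mk.localInverseAt p).trans (chartAt (ℂ × (Fin n → ℂ)) p)).symm.trans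
        ((D.isLocalHomeomorph_mk.localInverseAt p').trans
          (chartAt (ℂ × (Fin n → ℂ)) p'))).source := by
  set s := D.isLocalHomeomorph_mk.localInverseAt p with hs
  set s' := D.isLocalHomeomorph_mk.localInverseAt p' with hs'
  set c := chartAt (ℂ × (Fin n → ℂ)) p with hc
  have hsymm : ∀ q, s.symm q = Quotient.mk (MulAction.orbitRel D.G (HC n)) q := fun q =>
    congrFun (D.isLocalHomeomorph_mk.localInverseAt_symm (x := p)) q
  have hsymm' : ∀ q, s'.symm q = Quotient.mk (MulAction.orbitRel D.G (HC n)) q := fun q =>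
    congrFun (D.isLocalHomeomorph_mk.localInverseAt_symm (x := p')) q
  intro y hy
  have hyc : y ∈ c.target := by
    have := hy.1
    exact this.1
  have hys : Quotient.mk (MulAction.orbitRel D.G (HC n)) (c.symm y) ∈ s'.source := by
    have := hy.2.1
    rw [← hsymm]
    exact this
  have hq : Quotient.mk (MulAction.orbitRel D.G (HC n))
      (s' (Quotient.mk (MulAction.orbitRel D.G (HC n)) (c.symm y))) =
      Quotient.mk (MulAction.orbitRel D.G (HC n)) (c.symm y) := by
    rw [← hsymm']
    exact s'.left_inv hys
  obtain ⟨g, hg⟩ := MulAction.orbitRel_apply.1 (Quotient.exact hq)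
  change g • c.symm y = _ at hg
  obtain ⟨B, d, hB⟩ := D.exists_affine g.2
  have hcont : ContinuousAt (fun y' => g • c.symm y') y :=
    ((continuous_const_smul g).continuousAt).comp (c.symm.continuousAt hyc)
  have hmem : g • c.symm y ∈ s'.target := by
    rw [hg]
    exact s'.map_source hys
  have hev : ∀ᶠ y' in nhds y, g • c.symm y' ∈ s'.target :=
    hcont.eventually (s'.open_target.mem_nhds hmem)
  have hev2 : ∀ᶠ y' in nhds y, y' ∈ c.target := c.open_target.mem_nhds hyc
  have haff : ContDiffAt ℂ ω (fun y' => B y' + d) y := by fun_prop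
  refine (haff.congr_of_eventuallyEq ?_).contDiffWithinAt
  filter_upwards [hev, hev2] with y' h1 h2
  change ((s' (s.symm (c.symm y')) : HC n) : ℂ × (Fin n → ℂ)) = _
  have h3 : Quotient.mk (MulAction.orbitRel D.G (HC n)) (c.symm y') =
      Quotient.mk (MulAction.orbitRel D.G (HC n)) (g • c.symm y') :=
    Quotient.sound (MulAction.orbitRel_apply.2 ⟨g⁻¹, inv_smul_smul g _⟩)
  rw [hsymm, h3, ← hsymm', s'.right_inv h1]
  refine (hB (c.symm y')).trans ?_
  rw [chartAt_symm_coe p h2]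

instance isManifold_T : IsManifold 𝓘(ℂ, ℂ × (Fin n → ℂ)) ω D.T := by
  refine isManifold_of_contDiffOn _ _ _ ?_
  rintro _ _ ⟨x, rfl⟩ ⟨x', rfl⟩
  simpa using! D.contDiffOn_transition _ _

end Datum

end InoueType

end

/-!
Pulled back to the convex set `ℍ × ℂ^n`, the Lee form has a primitive `f`, which every deck
transformation changes by a constant. On translations these constants define a linear form on
`ℝ × ℂ^n` which, as `g₀` normalizes the translations, is fixed by `M`; it vanishes because `1` is
not an eigenvalue of `M`. Hence `e^{-f} Ω` is a Kähler form which is invariant under the lattice and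
multiplied by a constant under `g₀`.

Average it over the lattice torus `(ℝ × ℂ^n) / ⟨u_i⟩` in the fiber over a point of `Im w > 0`. Since
the form is closed, its averaged restriction to `ℝ × ℂ^n` does not depend on the point, so it is a
constant `2`-form which `A = α ⊕ Rᵀ` multiplies by a constant. Restricted to `ℂ^n` it is the
fundamental form of a Hermitian inner product, for which `Rᵀ` is therefore a similitude. So `Rᵀ` and
with it `A` are semisimple; in the basis `u_i` the matrix of `A` is `Mᵀ`, and `M` is diagonalizable.
-/

noncomputable section

section LinearAlgebra

open Module Polynomial

theorem isSemisimple_of_similitude {K V : Type*} [Field K] [AddCommGroup V] [Module K V]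
    [FiniteDimensional K V] {B : LinearMap.BilinForm K V} (hrefl : B.IsRefl)
    (hB : ∀ x, B x x = 0 → x = 0) {N : End K V} {c : K} (hc : c ≠ 0)
    (hN : ∀ x y, B (N x) (N y) = c * B x y) : N.IsSemisimple := by
  have hinj : Function.Injective N := (injective_iff_map_eq_zero N).2 fun x hx =>
    hB x <| (mul_eq_zero.1 (by rw [← hN, hx, map_zero])).resolve_left hc
  refine End.isSemisimple_iff.2 fun p hp => ⟨B.orthogonal p, fun y hy x hx => ?_, ?_⟩
  · have hmap : p.map N = p := Submodule.eq_of_le_of_finrank_eq (Submodule.map_le_iff_le_comap.2 hp)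
      (Submodule.equivMapOfInjective N hinj p).symm.finrank_eq
    obtain ⟨x, hx', rfl⟩ := hmap.ge hx
    change B (N x) (N y) = 0
    rw [hN, show B x y = 0 from hy x hx', mul_zero]
  · refine (LinearMap.BilinForm.restrict_nondegenerate_iff_isCompl_orthogonal hrefl).1 ?_
    exact ⟨fun x hx => Subtype.ext (hB x (hx x)), fun x hx => Subtype.ext (hB x (hx x))⟩

theorem isSemisimple_prodMap {K V W : Type*} [Field K] [AddCommGroup V] [Module K V]
    [FiniteDimensional K V] [AddCommGroup W] [Module K W] [FiniteDimensional K W]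
    {f : End K V} {g : End K W} (hf : f.IsSemisimple) (hg : g.IsSemisimple) :
    End.IsSemisimple (f.prodMap g) := by
  classical
  let q := UniqueFactorizationMonoid.radical (minpoly K f * minpoly K g)
  have hfg : minpoly K f * minpoly K g ≠ 0 :=
    mul_ne_zero hf.minpoly_squarefree.ne_zero hg.minpoly_squarefree.ne_zero
  have hqf : aeval f q = 0 := (minpoly.dvd_iff).1 <|
    (UniqueFactorizationMonoid.dvd_radical_iff hf.minpoly_squarefree.isRadical hfg).2
      (dvd_mul_right _ _)
  have hqg : aeval g q = 0 := (minpoly.dvd_iff).1 <|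
    (UniqueFactorizationMonoid.dvd_radical_iff hg.minpoly_squarefree.isRadical hfg).2
      (dvd_mul_left _ _)
  refine End.isSemisimple_of_squarefree_aeval_eq_zero
    (UniqueFactorizationMonoid.squarefree_radical (a := minpoly K f * minpoly K g)) ?_
  have h := aeval_algHom_apply (LinearMap.prodMapAlgHom K V W) (f, g) q
  rwa [aeval_prod_apply, hqf, hqg, Prod.mk_zero_zero, map_zero] at h

variable {ι K : Type*} [Fintype ι] [DecidableEq ι] [Field K]

theorem isSemisimple_toLin'_of_aeval_eq_zero {M : Matrix ι ι K} {q : K[X]} (hq : Squarefree q)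
    (h : aeval M q = 0) : End.IsSemisimple (Matrix.toLin' M) := by
  refine End.isSemisimple_of_squarefree_aeval_eq_zero hq ?_
  rw [← minpoly.dvd_iff, Matrix.minpoly_toLin', minpoly.dvd_iff, h]

theorem isSemisimple_toLin'_transpose {M : Matrix ι ι K} (h : End.IsSemisimple (Matrix.toLin' M)) :
    End.IsSemisimple (Matrix.toLin' Mᵀ) := by
  have hM := minpoly.aeval K M
  rw [← Matrix.minpoly_toLin'] at hM
  refine isSemisimple_toLin'_of_aeval_eq_zero h.minpoly_squarefree ?_
  rw [← Matrix.transpose_inj, Matrix.transpose_zero, ← hM]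
  simp only [aeval_eq_sum_range, Matrix.transpose_sum, Matrix.transpose_smul, Matrix.transpose_pow,
    Matrix.transpose_transpose]

theorem isSemisimple_toLin'_map [PerfectField K] (L : Type*) [Field L] [Algebra K L]
    {M : Matrix ι ι K} (h : End.IsSemisimple (Matrix.toLin' M)) :
    End.IsSemisimple (Matrix.toLin' (M.map (algebraMap K L))) := by
  have hsep : ((minpoly K M).map (algebraMap K L)).Separable := by
    rw [← Matrix.minpoly_toLin']
    exact (PerfectField.separable_iff_squarefree.2 h.minpoly_squarefree).map
  refine isSemisimple_toLin'_of_aeval_eq_zero hsep.squarefree ?_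
  have hM := aeval_algHom_apply ((Algebra.ofId K L).mapMatrix (m := ι)) M (minpoly K M)
  rw [minpoly.aeval, map_zero] at hM
  rw [aeval_map_algebraMap]
  exact hM

theorem exists_eq_conj_diagonal_of_isSemisimple [IsAlgClosed K] {M : Matrix ι ι K}
    (hM : End.IsSemisimple (Matrix.toLin' M)) : ∃ (P : GL ι K) (d : ι → K),
      M = (P : Matrix ι ι K) * Matrix.diagonal d * ((P⁻¹ : GL ι K) : Matrix ι ι K) := by
  have hspan : ⊤ ≤ Submodule.span K {x | ∃ μ : K, Matrix.toLin' M x = μ • x} := by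
    rw [← hM.iSup_eigenspace_eq_top]
    exact iSup_le fun μ x hx => Submodule.subset_span ⟨μ, End.mem_eigenspace_iff.1 hx⟩
  let e := Pi.basisFun K ι
  let b := (Basis.ofSpan hspan).reindex ((Basis.ofSpan hspan).indexEquiv e)
  have hb : ∀ i, ∃ μ : K, Matrix.toLin' M (b i) = μ • b i := fun i =>
    Basis.ofSpan_subset hspan (by rw [Basis.reindex_apply]; exact Set.mem_range_self _)
  choose d hd using hb
  have hdiag : LinearMap.toMatrix b b (Matrix.toLin' M) = Matrix.diagonal d := by
    ext i j
    rw [LinearMap.toMatrix_apply, hd, map_smul, Basis.repr_self]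
    obtain rfl | h := eq_or_ne i j <;> simp [*]
  refine ⟨⟨e.toMatrix b, b.toMatrix e, e.toMatrix_mul_toMatrix_flip b,
    b.toMatrix_mul_toMatrix_flip e⟩, d, ?_⟩
  change M = e.toMatrix b * Matrix.diagonal d * b.toMatrix e
  rw [← hdiag, basis_toMatrix_mul_linearMap_toMatrix_mul_basis_toMatrix]
  simp only [e, LinearMap.toMatrix_eq_toMatrix', LinearMap.toMatrix'_toLin']

end LinearAlgebra

namespace InoueType

namespace Datum

variable {n : ℕ} (D : Datum n)

/-- The basis of `ℝ × ℂ^n` formed by the vectors `u_i`; it spans the translation lattice. -/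
def basisU : Module.Basis (Fin (2 * n + 1)) ℝ (ℝ × (Fin n → ℂ)) :=
  basisOfLinearIndependentOfCardEqFinrank D.linearIndependent_u <| by
    simp [Module.finrank_pi_fintype, Complex.finrank_real_complex]
    ring

theorem basisU_apply (i : Fin (2 * n + 1)) : D.basisU i = D.u i := by
  simp [basisU]

/-- The real linear endomorphism `z ↦ Rᵀ z` of `ℂ^n`. -/
def N : Module.End ℝ (Fin n → ℂ) := (Matrix.toLin' D.Rᵀ).restrictScalars ℝ

theorem toMatrix_A : LinearMap.toMatrix D.basisU D.basisU D.A =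
    ((D.M : Matrix (Fin (2 * n + 1)) (Fin (2 * n + 1)) ℤ).map (Int.cast : ℤ → ℝ))ᵀ := by
  ext i j
  rw [LinearMap.toMatrix_apply, basisU_apply, A_u]
  simp_rw [← basisU_apply, map_sum, ← Int.cast_smul_eq_zsmul ℝ, map_smul, Module.Basis.repr_self]
  simp [Finsupp.single_apply]

theorem isDiagonalizable_of_isSemisimple (h : D.N.IsSemisimple) : IsDiagonalizable D.M := by
  let M' := (D.M : Matrix (Fin (2 * n + 1)) (Fin (2 * n + 1)) ℤ).map (Int.cast : ℤ → ℝ)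
  have hA : Module.End.IsSemisimple D.A :=
    isSemisimple_prodMap (Module.End.IsSemisimple_smul D.α Module.End.isSemisimple_id) h
  have hM' : Module.End.IsSemisimple (Matrix.toLin' M'ᵀ) := by
    refine (LinearEquiv.isSemisimple_iff D.A _ D.basisU.equivFun (LinearMap.ext fun v => ?_)).1 hA
    rw [← toMatrix_A]
    exact (LinearMap.toMatrix_mulVec_repr D.basisU D.basisU D.A v).symm
  have hM := isSemisimple_toLin'_map ℂ (isSemisimple_toLin'_transpose hM')
  rw [Matrix.transpose_transpose, Matrix.map_map] at hM
  have hcast : (algebraMap ℝ ℂ : ℝ → ℂ) ∘ (Int.cast : ℤ → ℝ) = Int.cast :=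
    funext fun k => map_intCast (algebraMap ℝ ℂ) k
  rw [hcast] at hM
  exact exists_eq_conj_diagonal_of_isSemisimple hM

theorem eq_zero_of_mulVec_eq {c : Fin (2 * n + 1) → ℝ}
    (hc : (D.M : Matrix (Fin (2 * n + 1)) (Fin (2 * n + 1)) ℤ).map (Int.cast : ℤ → ℝ) *ᵥ c = c) :
    c = 0 := by
  by_contra h0
  have hev : (complexEnd D.M).HasEigenvalue 1 := by
    refine Module.End.hasEigenvalue_of_hasEigenvector (x := fun i => (c i : ℂ)) ⟨?_, fun h => ?_⟩
    · rw [Module.End.mem_eigenspace_iff, one_smul]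
      ext i
      have hi := congrArg ((↑) : ℝ → ℂ) (congrFun hc i)
      simpa [complexEnd, Matrix.mulVec, dotProduct] using hi
    · exact h0 (funext fun i => by simpa using congrFun h i)
  exact D.im_ne_zero 1 hev (fun h => D.α_ne_one (by exact_mod_cast h.symm)) Complex.one_im

end Datum

end InoueType

section LatticeAverage

open MeasureTheory Module

instance vaddInvariantMeasure_submodule {R V : Type*} [Ring R] [AddCommGroup V] [Module R V]
    [MeasurableSpace V] [MeasurableAdd V] (S : Submodule R V) (μ : Measure V)
    [μ.IsAddLeftInvariant] : VAddInvariantMeasure S V μ :=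
  ⟨fun l s _ => measure_preimage_add μ (l : V) s⟩

variable {κ V F : Type*} [Fintype κ] [NormedAddCommGroup V] [NormedSpace ℝ V]
  [MeasurableSpace V] [BorelSpace V] [NormedAddCommGroup F] {b : Basis κ ℝ V} {f : V → F}

theorem integrableOn_parallelepiped (hf : Continuous f) :
    IntegrableOn f (parallelepiped b) b.addHaar :=
  hf.continuousOn.integrableOn_compact b.parallelepiped.isCompact

variable [NormedSpace ℝ F]

/-- The average of `f` over the period parallelepiped of `b`, with respect to the Haar measure that
gives it volume `1`. For `f` periodic under the lattice `span ℤ (range b)` this is the average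
of `f` over the torus `V ⧸ span ℤ (range b)`. -/
def latticeAverage (b : Basis κ ℝ V) (f : V → F) : F :=
  ∫ v in parallelepiped b, f v ∂b.addHaar

theorem map_latticeAverage {F' : Type*} [NormedAddCommGroup F'] [NormedSpace ℝ F']
    [CompleteSpace F] [CompleteSpace F'] (L : F →L[ℝ] F') (hf : Continuous f) :
    L (latticeAverage b f) = latticeAverage b (fun v => L (f v)) :=
  (L.integral_comp_comm (integrableOn_parallelepiped hf)).symm

theorem latticeAverage_pos {f : V → ℝ} (hf : Continuous f) (hpos : ∀ v, 0 < f v) :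
    0 < latticeAverage b f := by
  refine (setIntegral_pos_iff_support_of_nonneg_ae (ae_of_all _ fun v => (hpos v).le)
    (integrableOn_parallelepiped hf)).2 ?_
  rw [show Function.support f = Set.univ from Set.eq_univ_of_forall fun v => (hpos v).ne',
    Set.univ_inter, b.addHaar_self]
  exact one_pos

theorem hasFDerivAt_setIntegral_translate {X E : Type*} [TopologicalSpace X] [T2Space X]
    [MeasurableSpace X] [OpensMeasurableSpace X] [NormedAddCommGroup E] [NormedSpace ℝ E]
    [ProperSpace E] {k : E → F} {U : Set E} (hU : IsOpen U) (hk : ContDiffOn ℝ 1 k U)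
    {μ : Measure X} [IsFiniteMeasureOnCompacts μ] {K : Set X} (hK : IsCompact K) {x : X → E}
    (hx : ContinuousOn x K) {p : E} (hp : ∀ s ∈ K, p + x s ∈ U) :
    HasFDerivAt (fun q => ∫ s in K, k (q + x s) ∂μ) (∫ s in K, fderiv ℝ k (p + x s) ∂μ) p := by
  let C : Set E := (fun s => p + x s) '' K
  have hC : IsCompact C := hK.image_of_continuousOn (hx.const_add p)
  obtain ⟨δ, hδ, hsub⟩ := hC.exists_cthickening_subset_open hU (Set.image_subset_iff.2 hp)
  have hmem : ∀ q ∈ Metric.ball p δ, ∀ s ∈ K, q + x s ∈ Metric.cthickening δ C := fun q hq s hs =>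
    Metric.mem_cthickening_of_dist_le _ (p + x s) _ _ ⟨s, hs, rfl⟩
      (by simpa using (Metric.mem_ball.1 hq).le)
  have hfd : ContinuousOn (fderiv ℝ k) U := hk.continuousOn_fderiv_of_isOpen hU le_rfl
  obtain ⟨B, hB⟩ := hC.cthickening.exists_bound_of_continuousOn (hfd.mono hsub)
  have hint : ∀ q ∈ Metric.ball p δ, IntegrableOn (fun s => k (q + x s)) K μ := fun q hq =>
    (hk.continuousOn.comp (hx.const_add q) fun s hs => hsub (hmem q hq s hs)).integrableOn_compact
      hK
  have hball : Metric.ball p δ ∈ nhds p := Metric.ball_mem_nhds p hδ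
  refine hasFDerivAt_integral_of_dominated_of_fderiv_le (𝕜 := ℝ) (bound := fun _ => B)
    (F' := fun q s => fderiv ℝ k (q + x s)) hball
    (Filter.eventually_of_mem hball fun q hq => (hint q hq).1) (hint p (Metric.mem_ball_self hδ))
    ((hfd.comp (hx.const_add p) hp).integrableOn_compact hK).1
    (ae_restrict_of_forall_mem hK.measurableSet fun s hs q hq => hB _ (hmem q hq s hs))
    (integrableOn_const hK.measure_lt_top.ne)
    (ae_restrict_of_forall_mem hK.measurableSet fun s hs q hq => ?_)
  have hd : DifferentiableAt ℝ k (q + x s) :=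
    (hk.contDiffAt (hU.mem_nhds (hsub (hmem q hq s hs)))).differentiableAt one_ne_zero
  exact (hasFDerivAt_comp_add_right (x s)).2 hd.hasFDerivAt

theorem latticeAverage_eq_setIntegral_fundamentalDomain (b : Basis κ ℝ V) (f : V → F) :
    latticeAverage b f = ∫ v in ZSpan.fundamentalDomain b, f v ∂b.addHaar :=
  (setIntegral_congr_set (ZSpan.fundamentalDomain_ae_parallelepiped b b.addHaar)).symm

theorem latticeAverage_map {V' : Type*} [NormedAddCommGroup V'] [NormedSpace ℝ V']
    [MeasurableSpace V'] [BorelSpace V'] [FiniteDimensional ℝ V']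
    (b : Basis κ ℝ V) (T : V ≃L[ℝ] V') (f : V' → F) :
    latticeAverage (b.map T.toLinearEquiv) f = latticeAverage b (fun v => f (T v)) := by
  have hT : MeasurePreserving T b.addHaar (b.map T.toLinearEquiv).addHaar :=
    ⟨T.continuous.measurable, Basis.map_addHaar b T⟩
  have himage : T '' parallelepiped b = parallelepiped (b.map T.toLinearEquiv) :=
    image_parallelepiped (T.toLinearEquiv : V →ₗ[ℝ] V') b
  rw [latticeAverage, latticeAverage, ← himage]
  exact hT.setIntegral_image_emb T.toHomeomorph.measurableEmbedding f _

variable [FiniteDimensional ℝ V]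

theorem addHaar_eq_addHaar_of_span_eq {κ' : Type*} [Fintype κ'] {b' : Basis κ' ℝ V}
    (h : Submodule.span ℤ (Set.range b) = Submodule.span ℤ (Set.range b')) :
    b.addHaar = b'.addHaar := by
  have hb := ZSpan.isAddFundamentalDomain b b'.addHaar
  rw [h] at hb
  refine (b.addHaar_eq_iff b'.addHaar).2 ?_
  calc b'.addHaar (parallelepiped b)
      = b'.addHaar (ZSpan.fundamentalDomain b) :=
        (measure_congr (ZSpan.fundamentalDomain_ae_parallelepiped b _)).symm
    _ = b'.addHaar (ZSpan.fundamentalDomain b') :=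
        hb.measure_eq (ZSpan.isAddFundamentalDomain b' _)
    _ = b'.addHaar (parallelepiped b') :=
        measure_congr (ZSpan.fundamentalDomain_ae_parallelepiped b' _)
    _ = 1 := b'.addHaar_self

theorem latticeAverage_eq_of_span_eq {κ' : Type*} [Fintype κ'] {b' : Basis κ' ℝ V}
    (h : Submodule.span ℤ (Set.range b) = Submodule.span ℤ (Set.range b'))
    (hf : ∀ l ∈ Submodule.span ℤ (Set.range b), ∀ v, f (l + v) = f v) :
    latticeAverage b f = latticeAverage b' f := by
  have hb' := ZSpan.isAddFundamentalDomain b' b.addHaar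
  rw [← h] at hb'
  rw [latticeAverage_eq_setIntegral_fundamentalDomain,
    latticeAverage_eq_setIntegral_fundamentalDomain, ← addHaar_eq_addHaar_of_span_eq h]
  exact (ZSpan.isAddFundamentalDomain b _).setIntegral_eq hb' fun l => hf l l.2

theorem latticeAverage_comp_add_right
    (hf : ∀ l ∈ Submodule.span ℤ (Set.range b), ∀ v, f (l + v) = f v) (a : V) :
    latticeAverage b (fun v => f (v + a)) = latticeAverage b f := by
  have hb := ZSpan.isAddFundamentalDomain b b.addHaar
  have hmp := measurePreserving_add_right b.addHaar a
  rw [latticeAverage_eq_setIntegral_fundamentalDomain,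
    latticeAverage_eq_setIntegral_fundamentalDomain,
    ← hmp.setIntegral_image_emb (measurableEmbedding_addRight a)]
  refine (hb.image_of_equiv (Equiv.addRight a) ?_ (Equiv.refl _) fun l v => ?_).setIntegral_eq hb
    fun l => hf l l.2
  · exact (measurePreserving_add_right b.addHaar (-a)).quasiMeasurePreserving
  · exact add_assoc (l : V) v a

theorem latticeAverage_comp_of_map_span_eq (T : V ≃L[ℝ] V)
    (hT : Submodule.span ℤ (Set.range (T ∘ b)) = Submodule.span ℤ (Set.range b))
    (hf : ∀ l ∈ Submodule.span ℤ (Set.range b), ∀ v, f (l + v) = f v) :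
    latticeAverage b (fun v => f (T v)) = latticeAverage b f := by
  rw [← latticeAverage_map]
  refine latticeAverage_eq_of_span_eq ?_ fun l hl => hf l ?_
  · rw [Basis.coe_map]; exact hT
  · rw [Basis.coe_map] at hl; exact hT.le hl

end LatticeAverage

namespace ComplexGeometry

variable {E : Type*} [NormedAddCommGroup E] [NormedSpace ℝ E] {k : ℕ} {U : Set E}

section Primitive

/-- A `1`-form on a vector space, viewed as a linear functional. -/
def oneFormCLM : (E [⋀^Fin 1]→L[ℝ] ℝ) ≃ₗᵢ[ℝ] (E →L[ℝ] ℝ) :=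
  (ContinuousAlternatingMap.ofSubsingletonLIE (0 : Fin 1)).symm

variable {θ : E → E [⋀^Fin 1]→L[ℝ] ℝ} {f : E → ℝ}

theorem exists_hasFDerivAt_of_extDeriv_eq_zero (hU : IsOpen U) (hconv : Convex ℝ U)
    (hθ : DifferentiableOn ℝ θ U) (hd : ∀ y ∈ U, extDeriv θ y = 0) :
    ∃ f : E → ℝ, ∀ y ∈ U, HasFDerivAt f (oneFormCLM (θ y)) y := by
  refine hconv.exists_forall_hasFDerivAt_of_fderiv_symmetric hU
    ((oneFormCLM (E := E)).differentiable.comp_differentiableOn hθ) fun y hy a b => ?_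
  have h : extDeriv θ y ![a, b] =
      oneFormCLM (fderiv ℝ θ y a) b - oneFormCLM (fderiv ℝ θ y b) a := by
    rw [extDeriv, ContinuousAlternatingMap.alternatizeUncurryFin_apply, Fin.sum_univ_two]
    have h0 : Fin.removeNth (0 : Fin 2) ![a, b] = fun _ => b := by ext i; fin_cases i; rfl
    have h1 : Fin.removeNth (1 : Fin 2) ![a, b] = fun _ => a := by ext i; fin_cases i; rfl
    rw [h0, h1]
    simp only [Fin.val_zero, pow_zero, one_smul, Fin.val_one, pow_one, neg_smul, ← sub_eq_add_neg]
    rfl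
  rw [hd y hy] at h
  rw [show fderiv ℝ (fun z => oneFormCLM (θ z)) y = _ from (oneFormCLM (E := E)).comp_fderiv]
  exact sub_eq_zero.1 h.symm

theorem contDiffOn_one_of_hasFDerivAt {F : Type*} [NormedAddCommGroup F] [NormedSpace ℝ F]
    {f : E → F} {f' : E → E →L[ℝ] F} (hU : IsOpen U) (hf' : ContinuousOn f' U)
    (hf : ∀ y ∈ U, HasFDerivAt f (f' y) y) : ContDiffOn ℝ 1 f U := fun _ hy =>
  (contDiffAt_one_iff.2 ⟨f', U, hU.mem_nhds hy, hf', hf⟩).contDiffWithinAt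

theorem exists_comp_affine_eq_add_const (hU : IsOpen U) (hconn : IsPreconnected U)
    (hf : ∀ y ∈ U, HasFDerivAt f (oneFormCLM (θ y)) y) (B : E →L[ℝ] E) (c : E)
    (hmaps : ∀ y ∈ U, B y + c ∈ U)
    (hinv : ∀ y ∈ U, (θ (B y + c)).compContinuousLinearMap B = θ y) :
    ∃ a : ℝ, ∀ y ∈ U, f (B y + c) = f y + a := by
  have hfB : ∀ y ∈ U, HasFDerivAt (fun y => f (B y + c)) (oneFormCLM (θ y)) y := by
    intro y hy
    rw [← hinv y hy]
    exact (hf _ (hmaps y hy)).comp y (B.hasFDerivAt.add_const c)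
  exact hU.exists_eq_add_of_fderiv_eq hconn
    (fun y hy => (hfB y hy).differentiableAt.differentiableWithinAt)
    (fun y hy => (hf y hy).differentiableAt.differentiableWithinAt)
    fun y hy => (hfB y hy).fderiv.trans (hf y hy).fderiv.symm

theorem extDeriv_exp_neg_smul {η : E → E [⋀^Fin k]→L[ℝ] ℝ} {θ : E [⋀^Fin 1]→L[ℝ] ℝ} {y : E}
    (hη : DifferentiableAt ℝ η y) (hf : HasFDerivAt f (oneFormCLM θ) y)
    (hd : extDeriv η y = wedgeOne θ (η y)) :
    extDeriv (fun z => Real.exp (-f z) • η z) y = 0 := by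
  have h : HasFDerivAt (fun z => Real.exp (-f z) • η z)
      (Real.exp (-f y) • (fderiv ℝ η y + (-1 : ℝ) • (oneFormCLM θ).smulRight (η y))) y := by
    refine (hf.neg.exp.smul hη.hasFDerivAt).congr_fderiv ?_
    ext v
    simp
    ring
  rw [extDeriv, h.fderiv, ContinuousAlternatingMap.alternatizeUncurryFin_smul,
    ContinuousAlternatingMap.alternatizeUncurryFin_add,
    ContinuousAlternatingMap.alternatizeUncurryFin_smul]
  change Real.exp (-f y) • (extDeriv η y + (-1 : ℝ) • wedgeOne θ (η y)) = 0
  rw [hd]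
  module

end Primitive

theorem exists_comp_eq_const_of_extDeriv_eq_zero {V : Type*} [NormedAddCommGroup V]
    [NormedSpace ℝ V] (ι : V →L[ℝ] E) (hU : IsOpen U) (hconn : IsPreconnected U)
    {η : E → E [⋀^Fin k]→L[ℝ] ℝ} (hη : DifferentiableOn ℝ η U)
    (hd : ∀ y ∈ U, extDeriv η y = 0) (hinv : ∀ y ∈ U, ∀ w, η (y + ι w) = η y) :
    ∃ h : V [⋀^Fin k]→L[ℝ] ℝ, ∀ y ∈ U, (η y).compContinuousLinearMap ι = h := by
  let P := ContinuousAlternatingMap.compContinuousLinearMapCLM (ι := Fin k) (F := ℝ) ι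
  have hηd : ∀ y ∈ U, DifferentiableAt ℝ η y := fun y hy =>
    (hη y hy).differentiableAt (hU.mem_nhds hy)
  have hzero : ∀ y ∈ U, ∀ w, fderiv ℝ η y (ι w) = 0 := by
    intro y hy w
    have h := (hηd y hy).hasFDerivAt.hasLineDerivAt (ι w)
    simp only [HasLineDerivAt, ← map_smul, hinv y hy] at h
    exact h.unique (hasDerivAt_const 0 (η y))
  refine hU.exists_is_const_of_fderiv_eq_zero (𝕜 := ℝ) hconn
    (P.differentiable.comp_differentiableOn hη) fun y hy => ?_
  have h : fderiv ℝ (P ∘ η) y = P ∘L fderiv ℝ η y :=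
    (P.hasFDerivAt.comp y (hηd y hy).hasFDerivAt).fderiv
  ext e a
  have hcons : extDeriv η y (Fin.cons e (ι ∘ a)) = fderiv ℝ η y e (ι ∘ a) := by
    rw [extDeriv, ContinuousAlternatingMap.alternatizeUncurryFin_apply, Fin.sum_univ_succ]
    simp [hzero y hy]
  rw [hd y hy] at hcons
  exact (congr($h e a)).trans hcons.symm

section FiberMean

open Module

variable {κ V F : Type*} [Fintype κ] [NormedAddCommGroup V] [NormedSpace ℝ V]
  [MeasurableSpace V] [BorelSpace V] [NormedAddCommGroup F] [NormedSpace ℝ F]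
  (b : Basis κ ℝ V) {ι : V →L[ℝ] E}

/-- The average of `η` over the translates of `p` by a period parallelepiped of the lattice spanned
by `b`, embedded by `ι`. -/
def fiberMean (b : Basis κ ℝ V) (ι : V →L[ℝ] E) (η : E → F) (p : E) : F :=
  latticeAverage b fun v => η (p + ι v)

theorem hasFDerivAt_fiberMean [ProperSpace E] {η : E → F} (hU : IsOpen U)
    (hη : ContDiffOn ℝ 1 η U) {p : E} (hp : ∀ v, p + ι v ∈ U) :
    HasFDerivAt (fiberMean b ι η) (fiberMean b ι (fderiv ℝ η) p) p :=
  hasFDerivAt_setIntegral_translate hU hη b.parallelepiped.isCompact ι.continuous.continuousOn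
    fun v _ => hp v

theorem extDeriv_fiberMean [ProperSpace E] {η : E → E [⋀^Fin k]→L[ℝ] ℝ} (hU : IsOpen U)
    (hη : ContDiffOn ℝ 1 η U) (hd : ∀ y ∈ U, extDeriv η y = 0) {p : E} (hp : ∀ v, p + ι v ∈ U) :
    extDeriv (fiberMean b ι η) p = 0 := by
  have hcont : ContinuousOn (fderiv ℝ η) U := hη.continuousOn_fderiv_of_isOpen hU le_rfl
  rw [extDeriv, (hasFDerivAt_fiberMean b hU hη hp).fderiv, fiberMean,
    ← ContinuousAlternatingMap.alternatizeUncurryFinCLM_apply]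
  refine (map_latticeAverage (b := b) (F := E →L[ℝ] E [⋀^Fin k]→L[ℝ] ℝ)
    (ContinuousAlternatingMap.alternatizeUncurryFinCLM ℝ E ℝ)
    (hcont.comp_continuous (ι.continuous.const_add p) hp)).trans ?_
  have h : ∀ v, ContinuousAlternatingMap.alternatizeUncurryFinCLM ℝ E ℝ
      (fderiv ℝ η (p + ι v)) = 0 := fun v => hd _ (hp v)
  simp only [latticeAverage, Function.comp_apply, h, MeasureTheory.integral_zero]

theorem fiberMean_add [FiniteDimensional ℝ V] {η : E → F} {p : E}
    (hper : ∀ l ∈ Submodule.span ℤ (Set.range b), ∀ v, η (p + ι (l + v)) = η (p + ι v))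
    (w : V) :
    fiberMean b ι η (p + ι w) = fiberMean b ι η p := by
  rw [fiberMean, fiberMean, ← latticeAverage_comp_add_right (f := fun v => η (p + ι v)) hper w]
  simp only [map_add, add_assoc, add_comm (ι w)]

theorem exists_eq_latticeAverage_of_extDeriv_eq_zero [ProperSpace E] [FiniteDimensional ℝ V]
    {η : E → E [⋀^Fin k]→L[ℝ] ℝ} (hU : IsOpen U) (hconn : IsPreconnected U)
    (hη : ContDiffOn ℝ 1 η U) (hd : ∀ y ∈ U, extDeriv η y = 0) (hι : ∀ y ∈ U, ∀ v, y + ι v ∈ U)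
    (hper : ∀ l ∈ Submodule.span ℤ (Set.range b), ∀ y ∈ U, η (y + ι l) = η y) :
    ∃ h : V [⋀^Fin k]→L[ℝ] ℝ,
      ∀ y ∈ U, ∀ a, h a = latticeAverage b fun v => η (y + ι v) (ι ∘ a) := by
  obtain ⟨h, hh⟩ := exists_comp_eq_const_of_extDeriv_eq_zero ι hU hconn
    (η := fiberMean b ι η)
    (fun y hy => (hasFDerivAt_fiberMean b hU hη (hι y hy)).differentiableAt.differentiableWithinAt)
    (fun y hy => extDeriv_fiberMean b hU hη hd (hι y hy))
    (fun y hy w => fiberMean_add b (fun l hl v => by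
      rw [map_add, add_comm (ι l), ← add_assoc, hper l hl _ (hι y hy v)]) w)
  refine ⟨h, fun y hy a => ?_⟩
  rw [← hh y hy]
  exact map_latticeAverage (ContinuousAlternatingMap.apply ℝ E ℝ (ι ∘ a))
    (hη.continuousOn.comp_continuous (ι.continuous.const_add y) (hι y hy))

theorem comp_eq_smul_of_equivariant [FiniteDimensional ℝ V] {η : E → E [⋀^Fin k]→L[ℝ] ℝ}
    {h : V [⋀^Fin k]→L[ℝ] ℝ}
    (hh : ∀ y ∈ U, ∀ a, h a = latticeAverage b fun v => η (y + ι v) (ι ∘ a))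
    (hι : ∀ y ∈ U, ∀ v, y + ι v ∈ U)
    (hper : ∀ l ∈ Submodule.span ℤ (Set.range b), ∀ y ∈ U, η (y + ι l) = η y)
    {T : V ≃L[ℝ] V} (hT : Submodule.span ℤ (Set.range (T ∘ b)) = Submodule.span ℤ (Set.range b))
    {L : E →L[ℝ] E} (hLT : ∀ v, L (ι v) = ι (T v)) (hL : ∀ y ∈ U, L y ∈ U) {c : ℝ}
    (hc : ∀ y ∈ U, (η (L y)).compContinuousLinearMap L = c • η y) {y : E} (hy : y ∈ U) :
    h.compContinuousLinearMap (T : V →L[ℝ] V) = c • h := by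
  ext a
  calc h (T ∘ a)
      = latticeAverage b fun v => η (L y + ι v) (ι ∘ T ∘ a) := hh _ (hL y hy) _
    _ = latticeAverage b fun v => η (L y + ι (T v)) (ι ∘ T ∘ a) :=
        (latticeAverage_comp_of_map_span_eq (f := fun v => η (L y + ι v) (ι ∘ T ∘ a)) T hT
          fun l hl v => by
            rw [map_add, add_comm (ι l), ← add_assoc, hper l hl _ (hι _ (hL y hy) v)]).symm
    _ = latticeAverage b fun v => c • η (y + ι v) (ι ∘ a) := by
        congr 1 with v
        have := congr($(hc _ (hι y hy v)) (ι ∘ a))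
        simpa [Function.comp_def, hLT] using this
    _ = c • h a := by rw [hh y hy a]; exact MeasureTheory.integral_smul c _

end FiberMean

end ComplexGeometry

namespace ComplexGeometry

section RealStructure

variable {E : Type*} [NormedAddCommGroup E] [NormedSpace ℂ E] [NormedSpace ℝ E]
  [IsScalarTower ℝ ℂ E]

theorem contDiffGroupoid_complex_le_real :
    contDiffGroupoid ω 𝓘(ℂ, E) ≤ contDiffGroupoid ∞ 𝓘(ℝ, E) :=
  groupoid_of_pregroupoid_le _ _ fun _ _ h =>
    (ContDiffOn.restrict_scalars ℝ h).of_le le_top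

variable (E) in
theorem isManifold_real (X : Type*) [TopologicalSpace X] [ChartedSpace E X]
    [IsManifold 𝓘(ℂ, E) ω X] : IsManifold 𝓘(ℝ, E) ∞ X :=
  have := hasGroupoid_of_le (M := X) (G₁ := contDiffGroupoid ω 𝓘(ℂ, E)) inferInstance
    contDiffGroupoid_complex_le_real
  .mk' _ _ _

end RealStructure

end ComplexGeometry

namespace InoueType

namespace Datum

open ComplexGeometry

variable {n : ℕ} (D : Datum n)

section Quotient

/-- The chart of `T_M` at the image of `p`: a local section of the projection followed by the
inclusion of `ℍ × ℂ^n` into `ℂ × ℂ^n`. -/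
def quotChart (p : HC n) : OpenPartialHomeomorph D.T (ℂ × (Fin n → ℂ)) :=
  (D.isLocalHomeomorph_mk.localInverseAt p).trans (chartAt (ℂ × (Fin n → ℂ)) p)

/-- The projection `ℍ × ℂ^n → T_M`, extended to `ℂ × ℂ^n` by arbitrary values. -/
def proj (y : ℂ × (Fin n → ℂ)) : D.T :=
  Quotient.mk (MulAction.orbitRel D.G (HC n))
    ((chartAt (ℂ × (Fin n → ℂ)) (⟨(Complex.I, 0), by simp [mem_HC]⟩ : HC n)).symm y)

theorem quotChart_symm (p : HC n) : ⇑(D.quotChart p).symm = D.proj := by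
  have h := D.isLocalHomeomorph_mk.localInverseAt_symm (x := p)
  funext y
  exact congrFun h ((chartAt (ℂ × (Fin n → ℂ)) p).symm y)

theorem quotChart_mem_maximalAtlas (p : HC n) :
    D.quotChart p ∈ IsManifold.maximalAtlas 𝓘(ℂ, ℂ × (Fin n → ℂ)) ω D.T := by
  rw [IsManifold.maximalAtlas, mem_maximalAtlas_iff]
  rintro _ ⟨x, rfl⟩
  constructor <;> refine mem_groupoid_of_pregroupoid.2 ⟨?_, ?_⟩ <;>
    simpa [contDiffPregroupoid, quotChart] using! D.contDiffOn_transition _ _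

theorem mem_target_chartAt (p q : HC n) :
    (p : ℂ × (Fin n → ℂ)) ∈ (chartAt (ℂ × (Fin n → ℂ)) q).target := by
  refine (chartAt (ℂ × (Fin n → ℂ)) q).map_source (x := p) ?_
  rw [TopologicalSpace.Opens.chartAt_eq, OpenPartialHomeomorph.subtypeRestr_source]
  trivial

theorem chartAt_symm_apply_coe (p q : HC n) :
    (chartAt (ℂ × (Fin n → ℂ)) q).symm (p : ℂ × (Fin n → ℂ)) = p :=
  Subtype.ext (chartAt_symm_coe q (mem_target_chartAt p q))

theorem proj_coe (p : HC n) :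
    D.proj (p : ℂ × (Fin n → ℂ)) = Quotient.mk (MulAction.orbitRel D.G (HC n)) p := by
  rw [proj, chartAt_symm_apply_coe]

theorem mem_target_quotChart (p : HC n) : (p : ℂ × (Fin n → ℂ)) ∈ (D.quotChart p).target := by
  refine ⟨mem_target_chartAt p p, ?_⟩
  change (chartAt (ℂ × (Fin n → ℂ)) p).symm (p : ℂ × (Fin n → ℂ)) ∈
    (D.isLocalHomeomorph_mk.localInverseAt p).target
  rw [chartAt_symm_apply_coe]
  simp

theorem mdifferentiableAt_proj (p : HC n) :
    MDifferentiableAt 𝓘(ℝ, ℂ × (Fin n → ℂ)) 𝓘(ℝ, ℂ × (Fin n → ℂ)) D.proj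
      (p : ℂ × (Fin n → ℂ)) := by
  have := isManifold_real (ℂ × (Fin n → ℂ)) D.T
  rw [← D.quotChart_symm p]
  exact (contMDiffAt_symm_of_mem_maximalAtlas
    (StructureGroupoid.maximalAtlas_mono contDiffGroupoid_complex_le_real
      (D.quotChart_mem_maximalAtlas p)) (D.mem_target_quotChart p)).mdifferentiableAt (by simp)

section Affine

variable {g : Equiv.Perm (HC n)} {B : (ℂ × (Fin n → ℂ)) →L[ℝ] (ℂ × (Fin n → ℂ))}
  {c : ℂ × (Fin n → ℂ)}

theorem proj_affine (hg : g ∈ D.G) (hB : ∀ p : HC n, (g p : ℂ × (Fin n → ℂ)) = B p + c)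
    (p : HC n) : D.proj (B p + c) = D.proj p := by
  rw [← hB, proj_coe, proj_coe]
  exact Quotient.sound (MulAction.orbitRel_apply.2 ⟨⟨g, hg⟩, rfl⟩)

theorem mfderiv_proj_affine (hg : g ∈ D.G)
    (hB : ∀ p : HC n, (g p : ℂ × (Fin n → ℂ)) = B p + c) (p : HC n) :
    mfderiv 𝓘(ℝ, ℂ × (Fin n → ℂ)) 𝓘(ℝ, ℂ × (Fin n → ℂ)) D.proj p =
      (mfderiv 𝓘(ℝ, ℂ × (Fin n → ℂ)) 𝓘(ℝ, ℂ × (Fin n → ℂ)) D.proj (B p + c)).comp B := by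
  have haff : HasMFDerivAt 𝓘(ℝ, ℂ × (Fin n → ℂ)) 𝓘(ℝ, ℂ × (Fin n → ℂ))
      (fun y => B y + c) (p : ℂ × (Fin n → ℂ)) B :=
    (B.hasFDerivAt.add_const c).hasMFDerivAt
  have hd : MDifferentiableAt 𝓘(ℝ, ℂ × (Fin n → ℂ)) 𝓘(ℝ, ℂ × (Fin n → ℂ)) D.proj
      (B p + c) := by
    rw [← hB]
    exact D.mdifferentiableAt_proj _
  have hev : D.proj =ᶠ[nhds (p : ℂ × (Fin n → ℂ))] D.proj ∘ fun y => B y + c := by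
    filter_upwards [(HC n).isOpen.mem_nhds p.2] with y hy
    exact (D.proj_affine hg hB ⟨y, hy⟩).symm
  have h := HasMFDerivAt.comp (p : ℂ × (Fin n → ℂ)) hd.hasMFDerivAt haff
  exact (h.congr_of_eventuallyEq hev).mfderiv

end Affine

end Quotient

section Lift

variable {k : ℕ}

/-- The pull-back to `ℍ × ℂ^n` of a form on `T_M`. -/
def lift (η : DiffForm (ℂ × (Fin n → ℂ)) D.T k) (y : ℂ × (Fin n → ℂ)) :
    (ℂ × (Fin n → ℂ)) [⋀^Fin k]→L[ℝ] ℝ :=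
  (η (D.proj y)).compContinuousLinearMap
    (mfderiv 𝓘(ℝ, ℂ × (Fin n → ℂ)) 𝓘(ℝ, ℂ × (Fin n → ℂ)) D.proj y)

theorem inChart_quotChart (η : DiffForm (ℂ × (Fin n → ℂ)) D.T k) (p : HC n) :
    η.inChart (D.quotChart p) = D.lift η := by
  funext y
  unfold DiffForm.inChart lift
  rw [D.quotChart_symm p]

theorem exists_chart_inChart_eq_lift {y : ℂ × (Fin n → ℂ)} (hy : y ∈ HC n) :
    ∃ e ∈ IsManifold.maximalAtlas 𝓘(ℂ, ℂ × (Fin n → ℂ)) ω D.T, y ∈ e.target ∧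
      ∀ {k : ℕ} (η : DiffForm (ℂ × (Fin n → ℂ)) D.T k), η.inChart e = D.lift η :=
  ⟨_, D.quotChart_mem_maximalAtlas ⟨y, hy⟩, D.mem_target_quotChart ⟨y, hy⟩,
    fun η => D.inChart_quotChart η ⟨y, hy⟩⟩

theorem contDiffOn_lift {η : DiffForm (ℂ × (Fin n → ℂ)) D.T k}
    (hη : ∀ e ∈ IsManifold.maximalAtlas 𝓘(ℂ, ℂ × (Fin n → ℂ)) ω D.T,
      ContDiffOn ℝ ∞ (η.inChart e) e.target) : ContDiffOn ℝ ∞ (D.lift η) (HC n) := fun y hy => by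
  obtain ⟨e, he, hye, hlift⟩ := D.exists_chart_inChart_eq_lift hy
  rw [← hlift η]
  exact ((hη e he).contDiffAt (e.open_target.mem_nhds hye)).contDiffWithinAt

theorem lift_affine (η : DiffForm (ℂ × (Fin n → ℂ)) D.T k) {g : Equiv.Perm (HC n)}
    (hg : g ∈ D.G) {B : (ℂ × (Fin n → ℂ)) →L[ℝ] (ℂ × (Fin n → ℂ))} {c : ℂ × (Fin n → ℂ)}
    (hB : ∀ p : HC n, (g p : ℂ × (Fin n → ℂ)) = B p + c) (p : HC n) :
    (D.lift η (B p + c)).compContinuousLinearMap B = D.lift η p := by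
  -- `η x` and `η x'` live in the tangent spaces at `x` and `x'`, so `proj_affine` cannot
  -- be used to rewrite the base point.
  have hη : ∀ x x' : D.T, x = x' → ∀ w : Fin k → ℂ × (Fin n → ℂ),
      (η x : (ℂ × (Fin n → ℂ)) [⋀^Fin k]→L[ℝ] ℝ) w =
        (η x' : (ℂ × (Fin n → ℂ)) [⋀^Fin k]→L[ℝ] ℝ) w := by
    rintro x _ rfl w
    rfl
  ext v
  unfold lift
  rw [D.mfderiv_proj_affine hg hB]
  exact hη _ _ (D.proj_affine hg hB p) _

end Lift

section Deck

theorem transl_mem_G {v : ℝ × (Fin n → ℂ)} (hv : v ∈ D.lattice) : transl v ∈ D.G := by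
  rw [lattice, ← Submodule.mem_toAddSubgroup, Submodule.span_int_eq_addSubgroupClosure] at hv
  induction hv using AddSubgroup.closure_induction with
  | mem _ h =>
    obtain ⟨i, rfl⟩ := h
    exact Subgroup.subset_closure (Set.mem_insert_of_mem _ ⟨i, rfl⟩)
  | zero => rw [transl_zero]; exact one_mem _
  | add v w _ _ hv hw => rw [← transl_mul]; exact mul_mem hv hw
  | neg v _ hv => rw [← transl_inv]; exact inv_mem hv

/-- The inclusion `ℝ × ℂ^n → ℂ × ℂ^n`, whose image contains the translation vectors. -/
def incl (n : ℕ) : (ℝ × (Fin n → ℂ)) →L[ℝ] (ℂ × (Fin n → ℂ)) :=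
  Complex.ofRealCLM.prodMap (ContinuousLinearMap.id ℝ (Fin n → ℂ))

theorem incl_apply (v : ℝ × (Fin n → ℂ)) : incl n v = ((v.1 : ℂ), v.2) := rfl

theorem add_incl_mem {p : ℂ × (Fin n → ℂ)} (hp : p ∈ HC n) (v : ℝ × (Fin n → ℂ)) :
    p + incl n v ∈ HC n := by
  rw [mem_HC] at hp ⊢
  simpa [incl_apply] using hp

theorem lift_add_incl {k : ℕ} (η : DiffForm (ℂ × (Fin n → ℂ)) D.T k) {v : ℝ × (Fin n → ℂ)}
    (hv : v ∈ D.lattice) {p : ℂ × (Fin n → ℂ)} (hp : p ∈ HC n) :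
    D.lift η (p + incl n v) = D.lift η p :=
  D.lift_affine η (D.transl_mem_G hv) (B := ContinuousLinearMap.id ℝ _) (c := incl n v)
    (fun _ => rfl) ⟨p, hp⟩

/-- The generator `g₀`, as a real linear endomorphism of `ℂ × ℂ^n`. -/
def gLin : (ℂ × (Fin n → ℂ)) →L[ℝ] (ℂ × (Fin n → ℂ)) :=
  (D.α • ContinuousLinearMap.id ℝ ℂ).prodMap (LinearMap.toContinuousLinearMap D.N)

theorem gLin_apply (p : ℂ × (Fin n → ℂ)) : D.gLin p = (D.α * p.1, D.N p.2) := by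
  ext <;> simp [gLin]

theorem gLin_incl (v : ℝ × (Fin n → ℂ)) : D.gLin (incl n v) = incl n (D.A v) := by
  rw [gLin_apply, incl_apply, incl_apply, A_apply, Complex.ofReal_mul]
  rfl

theorem gLin_mem {p : ℂ × (Fin n → ℂ)} (hp : p ∈ HC n) : D.gLin p ∈ HC n := by
  rw [mem_HC] at hp ⊢
  rw [gLin_apply]
  simpa using mul_pos D.α_pos hp

theorem lift_gLin {k : ℕ} (η : DiffForm (ℂ × (Fin n → ℂ)) D.T k) {p : ℂ × (Fin n → ℂ)}
    (hp : p ∈ HC n) : (D.lift η (D.gLin p)).compContinuousLinearMap D.gLin = D.lift η p := by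
  have h := D.lift_affine η (Subgroup.subset_closure (Set.mem_insert D.g₀ _)) (B := D.gLin)
    (c := 0) (fun q => by rw [add_zero, gLin_apply]; rfl) ⟨p, hp⟩
  rwa [add_zero] at h

end Deck

section Lattice

theorem span_basisU : Submodule.span ℤ (Set.range D.basisU) = D.lattice := by
  rw [funext D.basisU_apply, lattice]

theorem A_surjective : Function.Surjective D.A := by
  rw [← LinearMap.range_eq_top, ← top_le_iff, ← D.basisU.span_eq, Submodule.span_le]
  rintro _ ⟨i, rfl⟩
  obtain ⟨w, -, hw⟩ := D.exists_A_eq (v := D.basisU i)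
    (D.span_basisU ▸ Submodule.subset_span (Set.mem_range_self i))
  exact ⟨w, hw⟩

/-- The linear map `A` as an automorphism of `ℝ × ℂ^n`. -/
def AEquiv : (ℝ × (Fin n → ℂ)) ≃L[ℝ] (ℝ × (Fin n → ℂ)) :=
  (LinearEquiv.ofBijective D.A
    ⟨LinearMap.injective_iff_surjective.2 D.A_surjective, D.A_surjective⟩).toContinuousLinearEquiv

theorem span_AEquiv_basisU : Submodule.span ℤ (Set.range (D.AEquiv ∘ D.basisU)) =
    Submodule.span ℤ (Set.range D.basisU) := by
  rw [Set.range_comp, D.span_basisU]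
  have h : D.lattice.map (D.A.restrictScalars ℤ) = D.lattice :=
    le_antisymm (Submodule.map_le_iff_le_comap.2 fun _ hv => D.A_mem hv) fun _ hv =>
      D.exists_A_eq hv
  rw [← h, ← D.span_basisU, Submodule.map_span]
  rfl

theorem eq_zero_of_comp_A {l : (ℝ × (Fin n → ℂ)) →ₗ[ℝ] ℝ}
    (hl : ∀ v ∈ D.lattice, l (D.A v) = l v) : l = 0 := by
  have hfix : (fun i => l (D.u i)) = 0 := D.eq_zero_of_mulVec_eq <| funext fun i => by
    have h := hl _ (Submodule.subset_span ⟨i, rfl⟩ : D.u i ∈ D.lattice)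
    rw [A_u, map_sum] at h
    simp_rw [map_zsmul, zsmul_eq_mul] at h
    exact h
  refine D.basisU.ext fun i => ?_
  rw [basisU_apply]
  exact congrFun hfix i

theorem exists_linearMap_add_incl {f : ℂ × (Fin n → ℂ) → ℝ}
    (hf : ∀ i, ∃ c, ∀ p ∈ HC n, f (p + incl n (D.u i)) = f p + c) :
    ∃ l : (ℝ × (Fin n → ℂ)) →ₗ[ℝ] ℝ,
      ∀ v ∈ D.lattice, ∀ p ∈ HC n, f (p + incl n v) = f p + l v := by
  choose c hc using hf
  refine ⟨D.basisU.constr ℝ c, fun v hv => ?_⟩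
  rw [lattice, ← Submodule.mem_toAddSubgroup, Submodule.span_int_eq_addSubgroupClosure] at hv
  induction hv using AddSubgroup.closure_induction with
  | mem _ h =>
    obtain ⟨i, rfl⟩ := h
    rw [← basisU_apply, Module.Basis.constr_basis, basisU_apply]
    exact hc i
  | zero => simp
  | add v w _ _ hv hw =>
    intro p hp
    rw [map_add, ← add_assoc, hw _ (add_incl_mem hp v), hv p hp, map_add, add_assoc]
  | neg v _ hv =>
    intro p hp
    have h := hv _ (add_incl_mem hp (-v))
    rw [add_assoc, ← map_add, neg_add_cancel, map_zero, add_zero] at h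
    rw [h, map_neg (D.basisU.constr ℝ c), add_neg_cancel_right]

theorem add_incl_eq_of_gLin {f : ℂ × (Fin n → ℂ) → ℝ}
    (hf : ∀ i, ∃ c, ∀ p ∈ HC n, f (p + incl n (D.u i)) = f p + c)
    {c₀ : ℝ} (hc₀ : ∀ p ∈ HC n, f (D.gLin p) = f p + c₀) {v : ℝ × (Fin n → ℂ)}
    (hv : v ∈ D.lattice) {p : ℂ × (Fin n → ℂ)} (hp : p ∈ HC n) : f (p + incl n v) = f p := by
  obtain ⟨l, hl⟩ := D.exists_linearMap_add_incl hf
  have hl0 : l = 0 := D.eq_zero_of_comp_A fun w hw => by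
    have h := hc₀ _ (add_incl_mem hp w)
    rw [map_add, gLin_incl, hl _ (D.A_mem hw) _ (D.gLin_mem hp), hl w hw p hp, hc₀ p hp] at h
    linarith
  rw [hl v hv p hp, hl0, LinearMap.zero_apply, add_zero]

end Lattice

end Datum

end InoueType

namespace ComplexGeometry

theorem twoForm_swap {F : Type*} [NormedAddCommGroup F] [NormedSpace ℝ F]
    (h : F [⋀^Fin 2]→L[ℝ] ℝ) (v w : F) : h ![v, w] = -h ![w, v] := by
  refine Eq.trans ?_ (h.toAlternatingMap.map_swap ![w, v] zero_ne_one)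
  change h _ = h _
  congr 1
  ext i : 1
  fin_cases i <;> rfl

section SesquilinearForm

variable {F : Type*} [NormedAddCommGroup F] [NormedSpace ℂ F] [NormedSpace ℝ F]
  [IsScalarTower ℝ ℂ F]

/-- The bilinear form `(v, w) ↦ h (v, i w)` attached to a `2`-form `h` on a complex vector space;
for the fundamental form of a Hermitian metric it is the underlying Riemannian metric. -/
def bilinOfTwoForm (h : F [⋀^Fin 2]→L[ℝ] ℝ) : LinearMap.BilinForm ℝ F :=
  LinearMap.mk₂ ℝ (fun v w => h ![v, Complex.I • w])
    (fun v v' w => h.vecCons_add _ v v')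
    (fun r v w => h.vecCons_smul _ r v)
    (fun v w w' => by
      rw [smul_add, twoForm_swap h v, twoForm_swap h v, twoForm_swap h v, h.vecCons_add, neg_add])
    (fun r v w => by
      rw [smul_comm, twoForm_swap h v, twoForm_swap h v, h.vecCons_smul, smul_neg])

theorem bilinOfTwoForm_apply (h : F [⋀^Fin 2]→L[ℝ] ℝ) (v w : F) :
    bilinOfTwoForm h v w = h ![v, Complex.I • w] := rfl

theorem isSymm_bilinOfTwoForm {h : F [⋀^Fin 2]→L[ℝ] ℝ}
    (hI : ∀ v w, h ![Complex.I • v, Complex.I • w] = h ![v, w]) : (bilinOfTwoForm h).IsSymm := by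
  refine ⟨fun v w => ?_⟩
  have hneg : h ![-w, Complex.I • v] = -h ![w, Complex.I • v] := by
    simpa using h.vecCons_smul ![Complex.I • v] (-1) w
  rw [bilinOfTwoForm_apply, bilinOfTwoForm_apply, ← hI, smul_smul,
    Complex.I_mul_I, neg_one_smul, twoForm_swap, hneg, neg_neg]

theorem isSemisimple_of_twoForm_eq_mul [FiniteDimensional ℝ F] {h : F [⋀^Fin 2]→L[ℝ] ℝ}
    (hI : ∀ v w, h ![Complex.I • v, Complex.I • w] = h ![v, w])
    (hpos : ∀ v, v ≠ 0 → 0 < h ![v, Complex.I • v]) {N : F →ₗ[ℂ] F} {c : ℝ} (hc : c ≠ 0)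
    (hN : ∀ v w, h ![N v, N w] = c * h ![v, w]) :
    Module.End.IsSemisimple (N.restrictScalars ℝ) := by
  refine isSemisimple_of_similitude (isSymm_bilinOfTwoForm hI).isRefl (fun v hv => ?_) hc
    fun v w => ?_
  · by_contra hv0
    exact (hpos v hv0).ne' hv
  · simp only [bilinOfTwoForm_apply, LinearMap.restrictScalars_apply, ← map_smul, hN]

end SesquilinearForm

end ComplexGeometry

namespace InoueType

namespace Datum

open ComplexGeometry

variable {n : ℕ} {D : Datum n}

theorem convex_HC : Convex ℝ (HC n : Set (ℂ × (Fin n → ℂ))) :=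
  (convex_halfSpace_im_gt 0).linear_preimage (LinearMap.fst ℝ ℂ (Fin n → ℂ))

variable (D) in
/-- A Kähler form on `ℍ × ℂ^n` on which the deck group `G_M` acts by homotheties, the translations
acting by isometries. This is what a locally conformally Kähler structure on `T_M` amounts to on the
universal cover. -/
structure KahlerCover where
  form : ℂ × (Fin n → ℂ) → (ℂ × (Fin n → ℂ)) [⋀^Fin 2]→L[ℝ] ℝ
  ratio : ℝ
  ratio_ne_zero : ratio ≠ 0
  contDiffOn : ContDiffOn ℝ 1 form (HC n)
  extDeriv_eq_zero : ∀ y ∈ HC n, extDeriv form y = 0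
  form_I_smul : ∀ y ∈ HC n, ∀ v w, form y ![Complex.I • v, Complex.I • w] = form y ![v, w]
  form_pos : ∀ y ∈ HC n, ∀ v, v ≠ 0 → 0 < form y ![v, Complex.I • v]
  form_add_incl : ∀ l ∈ D.lattice, ∀ y ∈ HC n, form (y + incl n l) = form y
  form_gLin : ∀ y ∈ HC n, (form (D.gLin y)).compContinuousLinearMap D.gLin = ratio • form y

theorem exists_primitive_lee (S : LCKStructure (ℂ × (Fin n → ℂ)) D.T) :
    ∃ f : ℂ × (Fin n → ℂ) → ℝ, ContDiffOn ℝ 1 f (HC n) ∧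
      (∀ y ∈ HC n, HasFDerivAt f (oneFormCLM (D.lift S.lee y)) y) ∧
      (∀ l ∈ D.lattice, ∀ y ∈ HC n, f (y + incl n l) = f y) ∧
      ∃ c, ∀ y ∈ HC n, f (D.gLin y) = f y + c := by
  have hlee := D.contDiffOn_lift S.smooth_lee
  obtain ⟨f, hf⟩ := exists_hasFDerivAt_of_extDeriv_eq_zero (HC n).isOpen convex_HC
    (hlee.differentiableOn (by simp)) fun y hy => by
      obtain ⟨e, he, hye, hlift⟩ := D.exists_chart_inChart_eq_lift hy
      rw [← hlift]
      exact S.lee_closed e he y hye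
  have hconn := (convex_HC (n := n)).isPreconnected
  obtain ⟨c, hc⟩ := exists_comp_affine_eq_add_const (HC n).isOpen hconn hf D.gLin 0
    (fun y hy => by rw [add_zero]; exact D.gLin_mem hy)
    (fun y hy => by rw [add_zero]; exact D.lift_gLin S.lee hy)
  simp only [add_zero] at hc
  refine ⟨f, contDiffOn_one_of_hasFDerivAt (HC n).isOpen
    (oneFormCLM.continuous.comp_continuousOn hlee.continuousOn) hf, hf, fun l hl y hy => ?_, c, hc⟩
  refine D.add_incl_eq_of_gLin (fun i => ?_) hc hl hy
  exact exists_comp_affine_eq_add_const (HC n).isOpen hconn hf (.id ℝ _) _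
    (fun y hy => add_incl_mem hy _)
    fun y hy => D.lift_add_incl S.lee (Submodule.subset_span ⟨i, rfl⟩) hy

theorem nonempty_kahlerCover (S : LCKStructure (ℂ × (Fin n → ℂ)) D.T) :
    Nonempty (KahlerCover D) := by
  obtain ⟨f, hfC, hf, hfper, c, hc⟩ := exists_primitive_lee S
  have hΩ := D.contDiffOn_lift S.smooth_Ω
  refine ⟨{
    form := fun y => Real.exp (-f y) • D.lift S.Ω y
    ratio := Real.exp (-c)
    ratio_ne_zero := (Real.exp_pos _).ne'
    contDiffOn := hfC.neg.exp.smul (hΩ.of_le (by simp))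
    extDeriv_eq_zero := fun y hy => ?_
    form_I_smul := fun y hy v w => ?_
    form_pos := fun y hy v hv => ?_
    form_add_incl := fun l hl y hy => ?_
    form_gLin := fun y hy => ?_ }⟩
  · refine extDeriv_exp_neg_smul
      ((hΩ.contDiffAt ((HC n).isOpen.mem_nhds hy)).differentiableAt (by simp)) (hf y hy) ?_
    obtain ⟨e, he, hye, hlift⟩ := D.exists_chart_inChart_eq_lift hy
    rw [← hlift, ← hlift]
    exact S.d_Ω e he y hye
  · obtain ⟨e, he, hye, hlift⟩ := D.exists_chart_inChart_eq_lift hy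
    rw [← hlift]
    exact congrArg (Real.exp (-f y) * ·) (S.invariant e he y hye v w)
  · obtain ⟨e, he, hye, hlift⟩ := D.exists_chart_inChart_eq_lift hy
    rw [← hlift]
    exact mul_pos (Real.exp_pos _) (S.positive e he y hye v hv)
  · rw [hfper l hl y hy, D.lift_add_incl S.Ω hl hy]
  · rw [hc y hy, neg_add, Real.exp_add, ← D.lift_gLin S.Ω hy, mul_comm, mul_smul]
    rfl

namespace KahlerCover

theorem exists_averagedForm (K : KahlerCover D) :
    ∃ h : (ℝ × (Fin n → ℂ)) [⋀^Fin 2]→L[ℝ] ℝ,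
      (∀ y ∈ HC n, ∀ a, h a =
        latticeAverage D.basisU fun v => K.form (y + incl n v) (incl n ∘ a)) ∧
      h.compContinuousLinearMap (D.AEquiv : (ℝ × (Fin n → ℂ)) →L[ℝ] (ℝ × (Fin n → ℂ))) =
        K.ratio • h := by
  have hadd : ∀ y ∈ HC n, ∀ v, y + incl n v ∈ HC n := fun y hy => add_incl_mem hy
  have hper : ∀ l ∈ Submodule.span ℤ (Set.range D.basisU), ∀ y ∈ HC n,
      K.form (y + incl n l) = K.form y := by
    rw [D.span_basisU]
    exact K.form_add_incl
  obtain ⟨h, hh⟩ := exists_eq_latticeAverage_of_extDeriv_eq_zero D.basisU (HC n).isOpen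
    convex_HC.isPreconnected K.contDiffOn K.extDeriv_eq_zero hadd hper
  exact ⟨h, hh, comp_eq_smul_of_equivariant D.basisU hh hadd hper D.span_AEquiv_basisU D.gLin_incl
    (fun y hy => D.gLin_mem hy) K.form_gLin (y := (Complex.I, 0)) (by simp [mem_HC])⟩

theorem exists_averagedForm_restrict (K : KahlerCover D) :
    ∃ g : (Fin n → ℂ) [⋀^Fin 2]→L[ℝ] ℝ,
      (∀ v w, g ![v, w] = latticeAverage D.basisU
        fun t => K.form ((Complex.I, 0) + incl n t) ![(0, v), (0, w)]) ∧
      ∀ v w, g ![Matrix.toLin' D.Rᵀ v, Matrix.toLin' D.Rᵀ w] = K.ratio * g ![v, w] := by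
  obtain ⟨h, hh, hA⟩ := K.exists_averagedForm
  have hpair : ∀ v w : Fin n → ℂ,
      LinearMap.inr ℝ ℝ (Fin n → ℂ) ∘ ![v, w] = ![(0, v), (0, w)] := fun v w => by
    ext i : 1
    fin_cases i <;> rfl
  refine ⟨h.compContinuousLinearMap (.inr ℝ ℝ (Fin n → ℂ)), fun v w => ?_, fun v w => ?_⟩
  · refine (hh (Complex.I, 0) (by simp [mem_HC]) _).trans ?_
    congr 1 with t
    congr 1
    ext i : 1
    fin_cases i <;> simp [incl_apply]
  · have hAN : ∀ v, D.AEquiv (0, v) = (0, Matrix.toLin' D.Rᵀ v) := fun v => by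
      change D.A (0, v) = _
      simp [A_apply]
    have hApair : D.AEquiv ∘ ![(0, v), (0, w)] =
        ![(0, Matrix.toLin' D.Rᵀ v), (0, Matrix.toLin' D.Rᵀ w)] := by
      ext i : 1
      fin_cases i <;> exact hAN _
    have hscale : h (D.AEquiv ∘ ![(0, v), (0, w)]) = K.ratio * h ![(0, v), (0, w)] :=
      congr($hA ![(0, v), (0, w)])
    rwa [hApair, ← hpair, ← hpair] at hscale

theorem isSemisimple_N (K : KahlerCover D) : D.N.IsSemisimple := by
  obtain ⟨g, hg, hN⟩ := K.exists_averagedForm_restrict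
  have hmem : ∀ t, ((Complex.I, 0) : ℂ × (Fin n → ℂ)) + incl n t ∈ HC n :=
    add_incl_mem (by simp [mem_HC])
  refine isSemisimple_of_twoForm_eq_mul (N := Matrix.toLin' D.Rᵀ) (fun v w => ?_)
    (fun v hv => ?_) K.ratio_ne_zero hN
  · rw [hg, hg]
    congr 1 with t
    simpa using K.form_I_smul _ (hmem t) (0, v) (0, w)
  · rw [hg]
    refine latticeAverage_pos ?_ fun t => ?_
    · exact (ContinuousAlternatingMap.apply ℝ _ ℝ ![(0, v), (0, Complex.I • v)]).continuous.comp
        (K.contDiffOn.continuousOn.comp_continuous (by fun_prop) hmem)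
    · simpa using K.form_pos _ (hmem t) (0, v) (by simpa using hv)

end KahlerCover

end Datum

end InoueType

end

theorem proposition4p4 (n : ℕ) (hn : 0 < n) (D : InoueType.Datum n)
    (hD : ¬ InoueType.IsDiagonalizable D.M) :
    IsEmpty (ComplexGeometry.LCKStructure (ℂ × (Fin n → ℂ)) D.T) := by
  refine ⟨fun S => hD ?_⟩
  obtain ⟨K⟩ := InoueType.Datum.nonempty_kahlerCover S
  exact D.isDiagonalizable_of_isSemisimple K.isSemisimple_N
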